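/- Let \(n\ge 0\) and let \((N,g)\) be a closed (compact, without boundary) smooth Riemannian manifold of dimension \(n+1\). Let \(W:\mathbb R\to[0,\infty)\) be a smooth symmetric double well potential: \(W(-t)=W(t)\) for all \(t\), the critical points of \(W\) are exactly \(0\) and \(\pm1\), \(W(\pm1)=0\), \(W''(\pm1)>0\), and \(0\) is a local maximum of \(W\). Let \(\varepsilon>0\). Let \(H^1(N)\) be the space of all \(u\in L^2(N)\) whose distributional gradient \(\nabla u\) is in \(L^2(N,TN)\), with norm \(\|u\|=\left(\int_N |u|^2+|\nabla u|^2\right)^{1/2}\), and for \(u\in H^1(N)\) put \[E_\varepsilon(u)=\int_N \varepsilon\frac{|\nabla u|^2}{2}+\frac{W(u)}{\varepsilon}.\] Inequalities between functions are understood almost everywhere. A continuous map \(\psi:[0,1]\to H^1(N)\) is called nested if \(\psi(t)\ge\psi(s)\) whenever \(t\le s\). Let \(\varphi:[0,1]\to H^1(N)\) be a continuous map such that \(|\varphi(t)|\le 1\) for all \(t\in[0,1]\), and let \(\kappa>0\). Then there exists a nested map \(\psi:[0,1]\to H^1(N)\) such that \(\psi(0)\ge\varphi(0)\), \(\psi(1)\le\varphi(1)\),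 \(|\psi(t)|\le1\) for all \(t\in[0,1]\), and \[\sup_{t\in[0,1]}E_\varepsilon(\psi(t))\le\sup_{t\in[0,1]}E_\varepsilon(\varphi(t))+\kappa.\] -/

import Mathlib

open scoped Manifold ContDiff Topology ENNReal
open MeasureTheory Set Filter

noncomputable section

namespace AllenCahn

/-- The model space `ℝ^(n+1)` of an `(n+1)`-dimensional manifold, with its Euclidean norm. -/
abbrev Model (n : ℕ) : Type := EuclideanSpace ℝ (Fin (n + 1))

/-- A smooth Riemannian metric on an `(n+1)`-dimensional smooth manifold `N` (without boundary);
`g.inner x v w` is the inner product of two tangent vectors `v`, `w` at `x`. -/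
abbrev SmoothMetric (n : ℕ) (N : Type*) [TopologicalSpace N] [ChartedSpace (Model n) N]
    [IsManifold (𝓡 (n + 1)) ∞ N] : Type _ :=
  Bundle.ContMDiffRiemannianMetric (𝓡 (n + 1)) ∞ (Model n)
    (fun x : N => TangentSpace (𝓡 (n + 1)) x)

/-- The smooth charts of `N`: all charts of the maximal smooth atlas. -/
abbrev charts (n : ℕ) (N : Type*) [TopologicalSpace N] [ChartedSpace (Model n) N] :
    Set (OpenPartialHomeomorph N (Model n)) :=
  IsManifold.maximalAtlas (𝓡 (n + 1)) ∞ N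

section Riemannian

variable {n : ℕ} {N : Type*} [TopologicalSpace N] [ChartedSpace (Model n) N]

/-- The coordinate vector field `∂ᵢ` of the chart `e`, at the point with coordinates `y`. -/
def coordVec (e : OpenPartialHomeomorph N (Model n)) (y : Model n) (i : Fin (n + 1)) :
    TangentSpace (𝓡 (n + 1)) (e.symm y) :=
  mfderiv (𝓡 (n + 1)) (𝓡 (n + 1)) e.symm y (EuclideanSpace.single i (1 : ℝ) : Model n)

/-- The vector in `ℝ^(n+1)` of the components of the vector field `X` in the chart `e`, as a
function of the coordinates `y`. -/
def coords (e : OpenPartialHomeomorph N (Model n))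
    (X : (x : N) → TangentSpace (𝓡 (n + 1)) x) (y : Model n) : Model n :=
  mfderiv (𝓡 (n + 1)) (𝓡 (n + 1)) e (e.symm y) (X (e.symm y))

variable [IsManifold (𝓡 (n + 1)) ∞ N]

/-- The matrix `g_ij = g(∂ᵢ, ∂ⱼ)` of the metric in the chart `e`. -/
def gram (g : SmoothMetric n N) (e : OpenPartialHomeomorph N (Model n)) (y : Model n) :
    Matrix (Fin (n + 1)) (Fin (n + 1)) ℝ :=
  Matrix.of fun i j => g.inner (e.symm y) (coordVec e y i) (coordVec e y j)

variable [MeasurableSpace N]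

/-- The Riemannian volume of the domain of the chart `e`, as a measure on `N` carried by that
domain: the image under `e⁻¹` of the measure `√(det g_ij) dy` on the range of `e`. -/
def chartVolume (g : SmoothMetric n N) (e : OpenPartialHomeomorph N (Model n)) : Measure N :=
  ((volume.restrict e.target).withDensity
    fun y => ENNReal.ofReal (Real.sqrt (gram g e y).det)).map e.symm

/-- The Riemannian volume measure of `(N, g)`: the least measure on `N` that dominates the chart
volume of every smooth chart. By the change of variables formula, the chart volumes of two charts
agree on the intersection of their domains, so that (on a manifold with a countable atlas) this
least measure is the one that restricts to `√(det g_ij) dy` on every chart domain. -/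
def vol (g : SmoothMetric n N) : Measure N :=
  ⨆ e ∈ charts n N, chartVolume g e

/-- `X` is the distributional gradient of the function `u`: `X` is a measurable vector field (its
components in every chart are measurable) and, in every chart, the `i`-th distributional
derivative of `u` is `g(X, ∂ᵢ)`. -/
structure IsWeakGradient (g : SmoothMetric n N) (u : N → ℝ)
    (X : (x : N) → TangentSpace (𝓡 (n + 1)) x) : Prop where
  measurable_coords : ∀ e ∈ charts n N,
    AEStronglyMeasurable (coords e X) (volume.restrict e.target)
  integral_eq : ∀ e ∈ charts n N, ∀ η : Model n → ℝ,
    ContDiff ℝ ∞ η → HasCompactSupport η → tsupport η ⊆ e.target → ∀ i : Fin (n + 1),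
      ∫ y, u (e.symm y) * fderiv ℝ η y (EuclideanSpace.single i 1) =
        - ∫ y, g.inner (e.symm y) (X (e.symm y)) (coordVec e y i) * η y

/-- The Sobolev space `H¹(N)`: the (classes of) functions in `L²(N)` whose distributional gradient
belongs to `L²(N, TN)`. -/
def H1 (g : SmoothMetric n N) : Type _ :=
  {u : Lp ℝ 2 (vol g) // ∃ X : (x : N) → TangentSpace (𝓡 (n + 1)) x,
    IsWeakGradient g u X ∧ ∫⁻ x, ENNReal.ofReal (g.inner x (X x) (X x)) ∂(vol g) < ⊤}

/-- An element of `H¹(N)` as a function, defined up to equality almost everywhere. -/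
instance (g : SmoothMetric n N) : CoeFun (H1 g) (fun _ => N → ℝ) := ⟨fun u => (u.1 : N → ℝ)⟩

/-- The gradient `∇u` of `u ∈ H¹(N)` (unique up to equality almost everywhere). -/
def H1.grad {g : SmoothMetric n N} (u : H1 g) : (x : N) → TangentSpace (𝓡 (n + 1)) x :=
  u.2.choose

/-- The distance `‖u - v‖ = (∫ |u - v|² + |∇u - ∇v|²)^(1/2)` given by the norm of `H¹(N)`. -/
def H1.normDist {g : SmoothMetric n N} (u v : H1 g) : ℝ≥0∞ :=
  (∫⁻ x, ENNReal.ofReal ((u x - v x) ^ 2 +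
    g.inner x (u.grad x - v.grad x) (u.grad x - v.grad x)) ∂(vol g)) ^ (1 / 2 : ℝ)

/-- Continuity of a path `φ : [0,1] → H¹(N)` with respect to the norm of `H¹(N)`. -/
def ContinuousPath {g : SmoothMetric n N} (φ : unitInterval → H1 g) : Prop :=
  ∀ t, Tendsto (fun s => (φ s).normDist (φ t)) (𝓝 t) (𝓝 0)

/-- A nested path `[0,1] → H¹(N)`: continuous, and `ψ(t) ≥ ψ(s)` a.e. whenever `t ≤ s`. -/
structure IsNested {g : SmoothMetric n N} (ψ : unitInterval → H1 g) : Prop where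
  continuousPath : ContinuousPath ψ
  antitone : ∀ t s : unitInterval, t ≤ s → ∀ᵐ x ∂(vol g), ψ s x ≤ ψ t x

/-- The Allen–Cahn energy `E_ε(u) = ∫ ε |∇u|² / 2 + W(u) / ε`, the integral of a nonnegative
function. -/
def energy {g : SmoothMetric n N} (W : ℝ → ℝ) (ε : ℝ) (u : H1 g) : ℝ≥0∞ :=
  ∫⁻ x, ENNReal.ofReal (ε * g.inner x (u.grad x) (u.grad x) / 2 + W (u x) / ε) ∂(vol g)

end Riemannian

/-- A smooth symmetric double well potential `W : ℝ → [0,∞)`: its critical points are exactly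
`0, 1, -1`; `±1` are nondegenerate minima with value `0`, and `0` is a local maximum. -/
structure IsDoubleWell (W : ℝ → ℝ) : Prop where
  contDiff : ContDiff ℝ ∞ W
  nonneg : ∀ t, 0 ≤ W t
  even : ∀ t, W (-t) = W t
  deriv_eq_zero_iff : ∀ t, deriv W t = 0 ↔ t = 0 ∨ t = 1 ∨ t = -1
  apply_one : W 1 = 0
  apply_neg_one : W (-1) = 0
  deriv2_one : 0 < deriv (deriv W) 1
  deriv2_neg_one : 0 < deriv (deriv W) (-1)
  isLocalMax : IsLocalMax W 0

end AllenCahn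

end

/-! The energy is submodular: `E(max(u,v)) + E(min(u,v)) ≤ E(u) + E(v)`. Indeed max and min only
exchange the values of `u` and `v` pointwise, and likewise the gradients
(`IsDoubleWell.energy_sup_add_energy_inf_le`). This allows short nested paths to be glued at almost
no cost in energy.

Short pieces: if `u` and `v` are close in `H¹`, the segment from `u` to `min(u,v)` is nested, starts
at `u`, ends below `v`, and stays close to `u`. Since `E(v) ≤ (1+δ) E(u) + C ‖v-u‖²` with `C`
independent of `u` and `v`, its energy barely exceeds that of `u`, and the admissible distance
depends only on an energy bound (`exists_nestedReach_of_sqDist_le`).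

Gluing: let `A` descend from above `u` to below `v`, and `B` from above `v` to below `w`, so `A(1) ≤
v ≤ B(0)`. Choose `z` almost minimizing `E` among functions between `A(1)` and `B(0)`. Follow
`max(A(t), z)` down to `z`, then `min(B(t), z)`. The functions `min(A(t), z)` and `max(B(t), z)`
compete with `z`, so by submodularity neither half rises above the old bound by more than the defect
of `z` (`NestedReach.trans`).

Connectedness of `[0,1]` then propagates reachability along `φ` (`nestedReach_of_continuousPath`).

The rest is Sobolev calculus on `N`: `∇|u| = sign(u) ∇u`, uniqueness of gradients, and continuity of
`u ↦ |u|` in `H¹`. These make max and min continuous operations with explicit gradients. -/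

noncomputable section

namespace AllenCahn

/-! ### Weak derivatives in Euclidean space: mollification and chain rules -/

section Euclidean

open scoped Convolution
open ContinuousLinearMap (lsmul)

set_option linter.unusedSectionVars false

variable {E : Type*} [NormedAddCommGroup E] [NormedSpace ℝ E] [FiniteDimensional ℝ E]
  [MeasurableSpace E] [BorelSpace E] {μ : Measure E} [μ.IsAddHaarMeasure]

/-- `h` is the weak derivative of `u` in the direction `v`, on the open set `Ω`. -/
def HasWeakDeriv (μ : Measure E) (Ω : Set E) (u h : E → ℝ) (v : E) : Prop :=
  ∀ η : E → ℝ, ContDiff ℝ ∞ η → HasCompactSupport η → tsupport η ⊆ Ω →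
    ∫ y, u y * fderiv ℝ η y v ∂μ = - ∫ y, h y * η y ∂μ

/-- Translations preserve Haar measure and depend continuously on `z` in the compact-open topology,
so composition with them is continuous in `L¹`. -/
theorem tendsto_lintegral_translate_sub {h : E → ℝ} (hh : Integrable h μ) :
    Tendsto (fun z : E => ∫⁻ x, ‖h (x - z) - h x‖ₑ ∂μ) (𝓝 0) (𝓝 0) := by
  have : Fact ((1 : ℝ≥0∞) ≤ 1) := ⟨le_rfl⟩
  have hL : MemLp h 1 μ := memLp_one_iff_integrable.2 hh
  let G : E → C(E, E) := fun z => ⟨fun x => x - z, by fun_prop⟩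
  have hG : Continuous G := by
    apply ContinuousMap.continuous_of_continuous_uncurry
    exact (continuous_snd.sub continuous_fst)
  have hm : ∀ z, MeasurePreserving (G z) μ μ := fun z => measurePreserving_sub_right μ z
  have key : Continuous (fun z => Lp.compMeasurePreserving (G z) (hm z) (hL.toLp h)) :=
    Continuous.compMeasurePreservingLp continuous_const hG hm (by simp)
  have h2 := (key.tendsto 0)
  rw [tendsto_iff_edist_tendsto_0] at h2
  refine h2.congr fun z => ?_
  rw [Lp.edist_def, eLpNorm_one_eq_lintegral_enorm]
  have h0 := Lp.coeFn_compMeasurePreserving (hL.toLp h) (hm 0)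
  have hz := Lp.coeFn_compMeasurePreserving (hL.toLp h) (hm z)
  have hz' := (hm z).quasiMeasurePreserving.ae_eq_comp hL.coeFn_toLp
  apply lintegral_congr_ae
  filter_upwards [h0, hz, hz', hL.coeFn_toLp] with x h0 hz hz' h1
  have e0 : (G 0) x = x := by simp [G]
  simp only [Pi.sub_apply, hz, h0, Function.comp_apply, e0, h1] at hz' ⊢
  rw [hz']
  rfl

/-- The kernel has mass one, so the error is an average of `h (x - z) - h x` over `z` in the
supporting ball; Tonelli then exchanges the integrals. -/
theorem convolution_normed_sub_le {h : E → ℝ} (hh : Integrable h μ) (φ : ContDiffBump (0 : E))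
    {c : ℝ≥0∞} (hc : ∀ z ∈ Metric.ball (0 : E) φ.rOut, ∫⁻ x, ‖h (x - z) - h x‖ₑ ∂μ ≤ c) :
    ∫⁻ x, ‖(φ.normed μ ⋆[lsmul ℝ ℝ, μ] h) x - h x‖ₑ ∂μ ≤ c := by
  have hint : ∫ z, φ.normed μ z ∂μ = 1 := φ.integral_normed
  have hnint : Integrable (φ.normed μ) μ := φ.integrable_normed
  have hle : ∀ x, ‖(φ.normed μ ⋆[lsmul ℝ ℝ, μ] h) x - h x‖ₑ ≤
      ∫⁻ z, ‖φ.normed μ z‖ₑ * ‖h (x - z) - h x‖ₑ ∂μ := by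
    intro x
    have hex : Integrable (fun z => φ.normed μ z * h (x - z)) μ := by
      have := (φ.hasCompactSupport_normed (μ := μ)).convolutionExists_left (lsmul ℝ ℝ)
        φ.continuous_normed hh.locallyIntegrable x
      simpa [ConvolutionExistsAt] using this
    have : (φ.normed μ ⋆[lsmul ℝ ℝ, μ] h) x - h x =
        ∫ z, φ.normed μ z * (h (x - z) - h x) ∂μ := by
      simp_rw [mul_sub]
      rw [integral_sub hex (hnint.mul_const _), integral_mul_const, hint, one_mul]
      rfl
    rw [this]
    refine (enorm_integral_le_lintegral_enorm _).trans (le_of_eq ?_)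
    simp [enorm_mul]
  have hmeas : AEMeasurable (Function.uncurry fun x z => ‖φ.normed μ z‖ₑ * ‖h (x - z) - h x‖ₑ)
      (μ.prod μ) := by
    have h1 : AEStronglyMeasurable (fun p : E × E => h (p.1 - p.2)) (μ.prod μ) :=
      hh.aestronglyMeasurable.comp_quasiMeasurePreserving (quasiMeasurePreserving_sub μ μ)
    have h2 : AEStronglyMeasurable (fun p : E × E => h p.1) (μ.prod μ) :=
      hh.aestronglyMeasurable.comp_fst
    have h3 : Continuous (fun p : E × E => φ.normed μ p.2) :=
      φ.continuous_normed.comp continuous_snd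
    exact h3.aestronglyMeasurable.enorm.mul (h1.sub h2).enorm
  calc ∫⁻ x, ‖(φ.normed μ ⋆[lsmul ℝ ℝ, μ] h) x - h x‖ₑ ∂μ
      ≤ ∫⁻ x, ∫⁻ z, ‖φ.normed μ z‖ₑ * ‖h (x - z) - h x‖ₑ ∂μ ∂μ := lintegral_mono hle
    _ = ∫⁻ z, ∫⁻ x, ‖φ.normed μ z‖ₑ * ‖h (x - z) - h x‖ₑ ∂μ ∂μ := lintegral_lintegral_swap hmeas
    _ = ∫⁻ z, ‖φ.normed μ z‖ₑ * ∫⁻ x, ‖h (x - z) - h x‖ₑ ∂μ ∂μ := by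
        refine lintegral_congr fun z => ?_
        rw [lintegral_const_mul' _ _ enorm_ne_top]
    _ ≤ ∫⁻ z, ‖φ.normed μ z‖ₑ * c ∂μ := by
        refine lintegral_mono fun z => ?_
        by_cases hz : z ∈ Metric.ball (0 : E) φ.rOut
        · exact mul_le_mul_right (hc z hz) _
        · have : φ.normed μ z = 0 := by
            rw [← φ.support_normed_eq (μ := μ)] at hz
            simpa using hz
          simp [this]
    _ = c := by
        rw [lintegral_mul_const'' _ hnint.aestronglyMeasurable.enorm]
        have : ∫⁻ z, ‖φ.normed μ z‖ₑ ∂μ = 1 := by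
          rw [← ofReal_integral_norm_eq_lintegral_enorm hnint]
          simp [abs_of_nonneg (φ.nonneg_normed _), hint]
        rw [this, one_mul]

/-- Mollifications of an integrable function converge to it in `L¹`. -/
theorem tendsto_lintegral_convolution_normed_sub {h : E → ℝ} (hh : Integrable h μ)
    {φ : ℕ → ContDiffBump (0 : E)} (hφ : Tendsto (fun k => (φ k).rOut) atTop (𝓝 0)) :
    Tendsto (fun k => ∫⁻ x, ‖((φ k).normed μ ⋆[lsmul ℝ ℝ, μ] h) x - h x‖ₑ ∂μ) atTop (𝓝 0) := by
  rw [ENNReal.tendsto_nhds_zero]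
  intro c hc
  have h1 := (ENNReal.tendsto_nhds_zero.1 (tendsto_lintegral_translate_sub hh)) c hc
  obtain ⟨r, hr, hrs⟩ := Metric.eventually_nhds_iff_ball.1 h1
  filter_upwards [hφ.eventually (gt_mem_nhds hr)] with k hk
  exact convolution_normed_sub_le hh (φ k) fun z hz => hrs z (Metric.ball_subset_ball hk.le hz)

/-- Mollification commutes with the weak derivative. -/
theorem HasWeakDeriv.fderiv_convolution {u h : E → ℝ} {v : E} (hu : Integrable u μ)
    (hw : HasWeakDeriv μ univ u h v) (φ : ContDiffBump (0 : E)) (x : E) :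
    DifferentiableAt ℝ (φ.normed μ ⋆[lsmul ℝ ℝ, μ] u) x ∧
    fderiv ℝ (φ.normed μ ⋆[lsmul ℝ ℝ, μ] u) x v = (φ.normed μ ⋆[lsmul ℝ ℝ, μ] h) x := by
  have hd := (φ.hasCompactSupport_normed (μ := μ)).hasFDerivAt_convolution_left (lsmul ℝ ℝ)
    (φ.contDiff_normed (n := 1)) hu.locallyIntegrable x
  refine ⟨hd.differentiableAt, ?_⟩
  rw [hd.fderiv]
  have hex := (HasCompactSupport.convolutionExists_left (μ := μ) ((lsmul ℝ ℝ).precompL E)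
    ((φ.hasCompactSupport_normed (μ := μ)).fderiv ℝ)
    ((φ.contDiff_normed (n := 1) (μ := μ)).continuous_fderiv (by simp)) hu.locallyIntegrable x)
  have h1 : (fderiv ℝ (φ.normed μ) ⋆[(lsmul ℝ ℝ).precompL E, μ] u) x v =
      ∫ t, fderiv ℝ (φ.normed μ) t v * u (x - t) ∂μ := by
    rw [convolution_def, ContinuousLinearMap.integral_apply hex]
    simp [ContinuousLinearMap.precompL_apply]
  rw [h1, convolution_def]
  -- The reflected kernel is the test function to insert in the weak identity; the substitution `t ↦
  -- x - t` turns both convolutions into its two sides.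
  set η : E → ℝ := fun y => φ.normed μ (x - y) with hη
  have e := hw η (by
      have := (φ.contDiff_normed (n := (⊤ : ℕ∞)) (μ := μ)); fun_prop)
    (by
      have := (φ.hasCompactSupport_normed (μ := μ)).comp_homeomorph (Homeomorph.subLeft x)
      simpa [hη, Function.comp_def] using this) (subset_univ _)
  have hη' : ∀ y, fderiv ℝ η y v = - fderiv ℝ (φ.normed μ) (x - y) v := by
    intro y
    have a : HasFDerivAt (φ.normed μ) (fderiv ℝ (φ.normed μ) (x - y)) (x - y) :=
      (((φ.contDiff_normed (n := 1) (μ := μ))).differentiable (by simp) _).hasFDerivAt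
    have b : HasFDerivAt (fun y : E => x - y) (-(ContinuousLinearMap.id ℝ E)) y :=
      (hasFDerivAt_id y).const_sub x
    have := (a.comp y b).fderiv
    rw [show η = φ.normed μ ∘ (fun y => x - y) from rfl, this]
    simp
  rw [← integral_sub_left_eq_self _ μ x]
  rw [← integral_sub_left_eq_self (fun t => ((lsmul ℝ ℝ) (φ.normed μ t)) (h (x - t))) μ x]
  simp only [sub_sub_cancel]
  simp only [hη', mul_neg, integral_neg, neg_inj] at e
  simp only [ContinuousLinearMap.lsmul_apply, smul_eq_mul]
  refine Eq.trans ?_ (e.trans ?_) <;> exact integral_congr_ae (ae_of_all _ fun y => mul_comm _ _)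

theorem integrable_mul_of_tsupport_subset {Ω : Set E} {u χ : E → ℝ}
    (hu : LocallyIntegrableOn u Ω μ) (hχ : Continuous χ) (hc : HasCompactSupport χ)
    (hs : tsupport χ ⊆ Ω) : Integrable (fun y => u y * χ y) μ := by
  have h1 : IntegrableOn u (tsupport χ) μ := hu.integrableOn_compact_subset hs hc
  have h2 : IntegrableOn (fun y => u y * χ y) (tsupport χ) μ :=
    h1.mul_continuousOn hχ.continuousOn hc
  rwa [integrableOn_iff_integrable_of_support_subset] at h2
  intro y hy
  exact subset_tsupport χ (right_ne_zero_of_mul hy)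

theorem tsupport_fderiv_apply_subset_tsupport (η : E → ℝ) (v : E) :
    tsupport (fun y => fderiv ℝ η y v) ⊆ tsupport η := by
  refine (closure_mono fun y hy => ?_).trans (tsupport_fderiv_subset ℝ (f := η))
  intro h0
  simp [h0] at hy

theorem exists_abs_le_of_hasCompactSupport {η : E → ℝ} (hη : Continuous η)
    (hc : HasCompactSupport η) : ∃ C, 0 ≤ C ∧ ∀ x, |η x| ≤ C := by
  obtain ⟨C, hC⟩ := hη.bounded_above_of_compact_support hc
  exact ⟨C, (norm_nonneg _).trans (hC 0), hC⟩

/-- Integrate by parts classically for `F ∘ uₖ`, with `uₖ`, `hₖ` the mollifications, and pass to the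
limit. The left side converges because `F` is 1-Lipschitz. On the right, `F'(uₖ) hₖ = F'(uₖ)(hₖ - h)
+ F'(uₖ) h`: the first term is handled by `L¹` convergence, the second by dominated convergence. -/
theorem HasWeakDeriv.comp_of_integrable {u h : E → ℝ} {v : E} {F F' : ℝ → ℝ}
    (hu : Integrable u μ) (hh : Integrable h μ) (hw : HasWeakDeriv μ univ u h v)
    (hF : ∀ t, HasDerivAt F (F' t) t) (hF' : Continuous F') (hb : ∀ t, |F' t| ≤ 1) :
    HasWeakDeriv μ univ (fun x => F (u x)) (fun x => F' (u x) * h x) v := by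
  intro η hη hηc _
  have hFc : Continuous F := continuous_iff_continuousAt.2 fun t => (hF t).continuousAt
  have hlip : ∀ a b, |F a - F b| ≤ |a - b| := fun a b => by
    have := Convex.norm_image_sub_le_of_norm_hasDerivWithin_le (f := F) (f' := F') (s := univ)
      (C := 1) (x := b) (y := a) (fun t _ => (hF t).hasDerivWithinAt) (fun t _ => hb t) convex_univ
      (mem_univ _) (mem_univ _)
    simpa using this
  have hηcont : Continuous η := hη.continuous
  have hd : Continuous (fun y => fderiv ℝ η y v) :=
    (hη.continuous_fderiv (by simp)).clm_apply continuous_const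
  have hdc : HasCompactSupport (fun y => fderiv ℝ η y v) :=
    hηc.mono' ((subset_tsupport _).trans (tsupport_fderiv_apply_subset_tsupport η v))
  obtain ⟨C, hC0, hC⟩ := exists_abs_le_of_hasCompactSupport hηcont hηc
  obtain ⟨D, hD0, hD⟩ := exists_abs_le_of_hasCompactSupport hd hdc
  -- The fixed ratio `rOut = 2 * rIn` is what the almost everywhere convergence `hae` requires (`K =
  -- 2`).
  let φ : ℕ → ContDiffBump (0 : E) := fun k =>
    { rIn := 1 / ((k : ℝ) + 1), rOut := 2 * (1 / ((k : ℝ) + 1)), rIn_pos := by positivity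
      rIn_lt_rOut := by
        have : (0 : ℝ) < 1 / ((k : ℝ) + 1) := by positivity
        linarith }
  have hφ : Tendsto (fun k => (φ k).rOut) atTop (𝓝 0) := by
    simpa [φ] using (tendsto_one_div_add_atTop_nhds_zero_nat (𝕜 := ℝ)).const_mul 2
  set uk : ℕ → E → ℝ := fun k => (φ k).normed μ ⋆[lsmul ℝ ℝ, μ] u with huk
  set hk : ℕ → E → ℝ := fun k => (φ k).normed μ ⋆[lsmul ℝ ℝ, μ] h with hhk
  have hukL := tendsto_lintegral_convolution_normed_sub hu hφ
  have hhkL := tendsto_lintegral_convolution_normed_sub hh hφ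
  have hae := ContDiffBump.ae_convolution_tendsto_right_of_locallyIntegrable (μ := μ) (K := 2) hφ
    (Eventually.of_forall fun k => le_rfl) hu.locallyIntegrable
  have hukc : ∀ k, Continuous (uk k) := fun k =>
    (((φ k).hasCompactSupport_normed (μ := μ)).contDiff_convolution_left (lsmul ℝ ℝ)
      ((φ k).contDiff_normed (n := 0)) hu.locallyIntegrable).continuous
  have hhkc : ∀ k, Continuous (hk k) := fun k =>
    (((φ k).hasCompactSupport_normed (μ := μ)).contDiff_convolution_left (lsmul ℝ ℝ)
      ((φ k).contDiff_normed (n := 0)) hh.locallyIntegrable).continuous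
  have hdiff : ∀ k x, HasFDerivAt (fun x => F (uk k x)) (F' (uk k x) • fderiv ℝ (uk k) x) x :=
    fun k x => (hF _).comp_hasFDerivAt x (hw.fderiv_convolution hu (φ k) x).1.hasFDerivAt
  have hfd : ∀ k x, fderiv ℝ (fun x => F (uk k x)) x v = F' (uk k x) * hk k x := fun k x => by
    rw [(hdiff k x).fderiv, smul_apply,
      (hw.fderiv_convolution hu (φ k) x).2, smul_eq_mul]
  have hcs : ∀ {f : E → ℝ} {χ : E → ℝ}, Continuous f → Continuous χ → HasCompactSupport χ →
      Integrable (fun x => f x * χ x) μ := fun hf hχ hχc =>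
    (hf.mul hχ).integrable_of_hasCompactSupport hχc.mul_left
  have hk_eq : ∀ k, ∫ x, F (uk k x) * fderiv ℝ η x v ∂μ =
      - ∫ x, F' (uk k x) * hk k x * η x ∂μ := fun k => by
    have := integral_mul_fderiv_eq_neg_fderiv_mul_of_integrable (μ := μ) (v := v)
      (f := fun x => F (uk k x)) (g := η)
      (by simp only [hfd]; exact hcs ((hF'.comp (hukc k)).mul (hhkc k)) hηcont hηc)
      (hcs (hFc.comp (hukc k)) hd hdc)
      (hcs (hFc.comp (hukc k)) hηcont hηc) (fun x _ => (hdiff k x).differentiableAt)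
      (fun x _ => hη.differentiable (by simp) x)
    simpa only [hfd] using this
  have hl : Tendsto (fun k => ∫ x, F (uk k x) * fderiv ℝ η x v ∂μ) atTop
      (𝓝 (∫ x, F (u x) * fderiv ℝ η x v ∂μ)) := by
    refine tendsto_integral_of_L1 _ ?_ ?_ ?_
    · exact (hFc.comp_aestronglyMeasurable hu.1).mul hd.aestronglyMeasurable
    · exact Eventually.of_forall fun k => hcs (hFc.comp (hukc k)) hd hdc
    · refine tendsto_of_tendsto_of_tendsto_of_le_of_le tendsto_const_nhds
        (h := fun k => ENNReal.ofReal D * ∫⁻ x, ‖uk k x - u x‖ₑ ∂μ) ?_ (fun _ => zero_le) fun k => ?_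
      · simpa using ENNReal.Tendsto.const_mul hukL (Or.inr ENNReal.ofReal_ne_top)
      · simp only
        rw [← lintegral_const_mul' _ _ ENNReal.ofReal_ne_top]
        refine lintegral_mono fun x => ?_
        rw [← sub_mul, enorm_mul, mul_comm]
        gcongr
        · rw [Real.enorm_eq_ofReal_abs]; exact ENNReal.ofReal_le_ofReal (hD x)
        · rw [Real.enorm_eq_ofReal_abs, Real.enorm_eq_ofReal_abs]
          exact ENNReal.ofReal_le_ofReal (hlip _ _)
  have hbd : ∀ x t, |F' t * h x * η x| ≤ C * |h x| := fun x t => by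
    rw [abs_mul, abs_mul]
    calc |F' t| * |h x| * |η x| ≤ 1 * |h x| * C := by gcongr; exacts [hb _, hC x]
      _ = _ := by ring
  have hI : ∀ k, Integrable (fun x => F' (uk k x) * h x * η x) μ := fun k =>
    (hh.norm.const_mul C).mono' (((hF'.comp (hukc k)).aestronglyMeasurable.mul hh.1).mul
      hηcont.aestronglyMeasurable) (ae_of_all _ fun x => hbd x _)
  have hr1 : Tendsto (fun k => ∫ x, F' (uk k x) * (hk k x - h x) * η x ∂μ) atTop (𝓝 0) := by
    have : Tendsto (fun k => ∫ x, F' (uk k x) * (hk k x - h x) * η x ∂μ) atTop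
      (𝓝 (∫ _, (0 : ℝ) ∂μ)) := by
      refine tendsto_integral_of_L1 _ aestronglyMeasurable_const ?_ ?_
      · refine Eventually.of_forall fun k => ?_
        simp only [mul_sub, sub_mul]
        refine (hcs ((hF'.comp (hukc k)).mul (hhkc k)) hηcont hηc).sub (hI k)
      · refine tendsto_of_tendsto_of_tendsto_of_le_of_le tendsto_const_nhds
          (h := fun k => ENNReal.ofReal C * ∫⁻ x, ‖hk k x - h x‖ₑ ∂μ) ?_ (fun _ => zero_le)
            fun k => ?_
        · simpa using ENNReal.Tendsto.const_mul hhkL (Or.inr ENNReal.ofReal_ne_top)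
        · simp only
          rw [← lintegral_const_mul' _ _ ENNReal.ofReal_ne_top]
          refine lintegral_mono fun x => ?_
          rw [sub_zero, Real.enorm_eq_ofReal_abs, Real.enorm_eq_ofReal_abs,
            ← ENNReal.ofReal_mul hC0]
          apply ENNReal.ofReal_le_ofReal
          rw [abs_mul, abs_mul]
          calc |F' (uk k x)| * |hk k x - h x| * |η x| ≤ 1 * |hk k x - h x| * C := by
                gcongr; exacts [hb _, hC x]
            _ = _ := by ring
    simpa using this
  have hr2 : Tendsto (fun k => ∫ x, F' (uk k x) * h x * η x ∂μ) atTop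
      (𝓝 (∫ x, F' (u x) * h x * η x ∂μ)) := by
    refine tendsto_integral_of_dominated_convergence (fun x => C * |h x|) (fun k =>
      ((hF'.comp (hukc k)).aestronglyMeasurable.mul hh.1).mul hηcont.aestronglyMeasurable)
      (hh.norm.const_mul C) (fun k => ae_of_all _ fun x => hbd x _) ?_
    · filter_upwards [hae] with x hx
      exact (((hF'.tendsto _).comp hx).mul_const _).mul_const _
  have hr : Tendsto (fun k => - ∫ x, F' (uk k x) * hk k x * η x ∂μ) atTop
      (𝓝 (- ∫ x, F' (u x) * h x * η x ∂μ)) := by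
    have := (hr1.add hr2).neg
    rw [zero_add] at this
    refine this.congr fun k => ?_
    rw [← integral_add]
    · congr 1
      refine integral_congr_ae (ae_of_all _ fun x => ?_)
      simp only; ring
    · simp only [mul_sub, sub_mul]
      refine (hcs ((hF'.comp (hukc k)).mul (hhkc k)) hηcont hηc).sub (hI k)
    · exact hI k
  simp only [hk_eq] at hl
  exact tendsto_nhds_unique hl hr

/-- Localization: multiply `u` by a cutoff `χ` equal to one near the support of the test function.
The product is integrable on the whole space, its weak derivative comes from the product rule, and
nothing has changed where `η` lives. -/
theorem HasWeakDeriv.comp {Ω : Set E} (hΩ : IsOpen Ω) {u h : E → ℝ} {v : E} {F F' : ℝ → ℝ}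
    (hu : LocallyIntegrableOn u Ω μ) (hh : LocallyIntegrableOn h Ω μ) (hw : HasWeakDeriv μ Ω u h v)
    (hF : ∀ t, HasDerivAt F (F' t) t) (hF' : Continuous F') (hb : ∀ t, |F' t| ≤ 1) :
    HasWeakDeriv μ Ω (fun x => F (u x)) (fun x => F' (u x) * h x) v := by
  intro η hη hηc hηΩ
  obtain ⟨K, hK, hηK, hKΩ⟩ := exists_compact_between hηc hΩ hηΩ
  obtain ⟨χ, hχ1, hχ0, -⟩ := exists_contMDiffMap_one_nhds_of_subset_interior (n := ⊤) 𝓘(ℝ, E)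
    (isClosed_tsupport η) hηK
  have hχ : ContDiff ℝ ∞ χ := χ.contMDiff.contDiff
  have hχs : tsupport χ ⊆ K := by
    refine closure_minimal (fun x hx => ?_) hK.isClosed
    by_contra hxK
    exact hx (hχ0 x hxK)
  have hχc : HasCompactSupport χ := hK.of_isClosed_subset (isClosed_tsupport _) hχs
  have hχd : Continuous (fun y => fderiv ℝ χ y v) :=
    (hχ.continuous_fderiv (by simp)).clm_apply continuous_const
  have hχdc : HasCompactSupport (fun y => fderiv ℝ χ y v) :=
    hχc.mono' ((subset_tsupport _).trans (tsupport_fderiv_apply_subset_tsupport _ v))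
  have hχds : tsupport (fun y => fderiv ℝ χ y v) ⊆ Ω :=
    (tsupport_fderiv_apply_subset_tsupport _ v).trans (hχs.trans hKΩ)
  have hu1 := integrable_mul_of_tsupport_subset hu hχ.continuous hχc (hχs.trans hKΩ)
  have hh1 := integrable_mul_of_tsupport_subset hh hχ.continuous hχc (hχs.trans hKΩ)
  have hu2 := integrable_mul_of_tsupport_subset hu hχd hχdc hχds
  have hw' : HasWeakDeriv μ univ (fun x => u x * χ x)
      (fun x => h x * χ x + u x * fderiv ℝ χ x v) v := by
    intro ξ hξ hξc _
    have hξd : Continuous (fun y => fderiv ℝ ξ y v) :=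
      (hξ.continuous_fderiv (by simp)).clm_apply continuous_const
    have hsub : tsupport (fun x => χ x * ξ x) ⊆ tsupport χ := tsupport_mul_subset_left
    have e := hw (fun x => χ x * ξ x) (hχ.mul hξ) hχc.mul_right (hsub.trans (hχs.trans hKΩ))
    have hfd : ∀ y, fderiv ℝ (fun x => χ x * ξ x) y v =
        χ y * fderiv ℝ ξ y v + fderiv ℝ χ y v * ξ y := by
      intro y
      rw [fderiv_fun_mul (hχ.differentiable (by simp) y) (hξ.differentiable (by simp) y)]
      simp [mul_comm]
    have i1 : Integrable (fun y => u y * (χ y * fderiv ℝ ξ y v)) μ :=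
      integrable_mul_of_tsupport_subset hu (hχ.continuous.mul hξd) hχc.mul_right
        (tsupport_mul_subset_left.trans (hχs.trans hKΩ))
    have i2 : Integrable (fun y => u y * (fderiv ℝ χ y v * ξ y)) μ :=
      integrable_mul_of_tsupport_subset hu (hχd.mul hξ.continuous) hχdc.mul_right
        (tsupport_mul_subset_left.trans hχds)
    have i3 : Integrable (fun y => h y * (χ y * ξ y)) μ :=
      integrable_mul_of_tsupport_subset hh (hχ.continuous.mul hξ.continuous) hχc.mul_right
        (tsupport_mul_subset_left.trans (hχs.trans hKΩ))
    simp only [hfd, mul_add] at e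
    rw [integral_add i1 i2] at e
    simp only [add_mul, mul_assoc]
    rw [integral_add i3 i2]
    linarith
  have key := hw'.comp_of_integrable hu1 (hh1.add hu2) hF hF' hb η hη hηc (subset_univ _)
  have hone : ∀ x ∈ tsupport η, χ x = 1 ∧ fderiv ℝ χ x v = 0 := by
    intro x hx
    have h1 : ∀ᶠ y in 𝓝 x, χ y = 1 := hχ1.filter_mono (nhds_le_nhdsSet hx)
    have h2 : (χ : E → ℝ) =ᶠ[𝓝 x] fun _ => (1 : ℝ) := h1
    refine ⟨h1.self_of_nhds, ?_⟩
    rw [h2.fderiv_eq]; simp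
  have hout : ∀ x, x ∉ tsupport η → η x = 0 ∧ fderiv ℝ η x v = 0 := by
    intro x hx
    refine ⟨image_eq_zero_of_notMem_tsupport hx, ?_⟩
    exact image_eq_zero_of_notMem_tsupport (f := fun y => fderiv ℝ η y v)
      (fun h => hx (tsupport_fderiv_apply_subset_tsupport η v h))
  convert key using 1
  · refine integral_congr_ae (ae_of_all _ fun x => ?_)
    by_cases hx : x ∈ tsupport η
    · simp [(hone x hx).1]
    · simp [(hout x hx).2]
  · congr 1
    refine integral_congr_ae (ae_of_all _ fun x => ?_)
    by_cases hx : x ∈ tsupport η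
    · simp [(hone x hx).1, (hone x hx).2]
    · simp [(hout x hx).1]

/-- Stampacchia's chain rule for the absolute value. -/
theorem HasWeakDeriv.abs {Ω : Set E} (hΩ : IsOpen Ω) {u h : E → ℝ} {v : E}
    (hu : LocallyIntegrableOn u Ω μ) (hh : LocallyIntegrableOn h Ω μ)
    (hw : HasWeakDeriv μ Ω u h v) :
    HasWeakDeriv μ Ω (fun x => |u x|) (fun x => (SignType.sign (u x) : ℝ) * h x) v := by
  intro η hη hηc hηΩ
  have hd : Continuous (fun y => fderiv ℝ η y v) :=
    (hη.continuous_fderiv (by simp)).clm_apply continuous_const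
  have hds := tsupport_fderiv_apply_subset_tsupport η v
  have hdc : HasCompactSupport (fun y => fderiv ℝ η y v) :=
    hηc.mono' ((subset_tsupport _).trans hds)
  -- Approximate `|t|` by `√(t² + δ²)`, whose derivative is bounded by one and tends to `sign t`,
  -- with limit `0` at `t = 0`.
  let δ : ℕ → ℝ := fun k => 1 / ((k : ℝ) + 1)
  have hδ : ∀ k, 0 < δ k := fun k => by positivity
  have hδ1 : ∀ k, δ k ≤ 1 := fun k => by
    have : (0 : ℝ) ≤ k := k.cast_nonneg
    simp only [δ]; rw [div_le_one (by positivity)]; linarith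
  have hδ0 : Tendsto δ atTop (𝓝 0) := tendsto_one_div_add_atTop_nhds_zero_nat
  have hpos : ∀ k t, 0 < t ^ 2 + δ k ^ 2 := fun k t => by have := hδ k; positivity
  have hcomp : ∀ k, ∫ x, √(u x ^ 2 + δ k ^ 2) * fderiv ℝ η x v ∂μ =
      - ∫ x, u x / √(u x ^ 2 + δ k ^ 2) * h x * η x ∂μ := by
    intro k
    refine hw.comp hΩ hu hh (F := fun t => √(t ^ 2 + δ k ^ 2))
      (F' := fun t => t / √(t ^ 2 + δ k ^ 2)) (fun t => ?_) ?_ (fun t => ?_) η hη hηc hηΩ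
    · have := (((hasDerivAt_id t).pow 2).add_const (δ k ^ 2)).sqrt (hpos k t).ne'
      convert! this using 1
      simp; field_simp
    · exact continuous_id.div (by fun_prop) fun t => (Real.sqrt_pos.2 (hpos k t)).ne'
    · rw [abs_div, abs_of_pos (Real.sqrt_pos.2 (hpos k t)), div_le_one (Real.sqrt_pos.2 (hpos k t))]
      apply Real.abs_le_sqrt; nlinarith [sq_nonneg (δ k)]
  have hum : AEStronglyMeasurable u (μ.restrict Ω) :=
    hu.aestronglyMeasurable
  have hhm : AEStronglyMeasurable h (μ.restrict Ω) := hh.aestronglyMeasurable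
  -- `u` and `h` are measurable only on `Ω`, but the integrands vanish off the support of `η`.
  have hrestr : ∀ {f : E → ℝ}, AEStronglyMeasurable f (μ.restrict Ω) → (∀ x, x ∉ tsupport η → f x = 0) →
      AEStronglyMeasurable f μ := by
    intro f hf h0
    have : f = Ω.indicator f := by
      refine (indicator_eq_self.2 fun x hx => ?_).symm
      by_contra hxΩ
      exact hx (h0 x fun h => hxΩ (hηΩ h))
    rw [this]
    exact (aestronglyMeasurable_indicator_iff hΩ.measurableSet).2 hf
  have hη0 : ∀ x, x ∉ tsupport η → η x = 0 := fun x hx => image_eq_zero_of_notMem_tsupport hx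
  have hd0 : ∀ x, x ∉ tsupport η → fderiv ℝ η x v = 0 := fun x hx =>
    image_eq_zero_of_notMem_tsupport (f := fun y => fderiv ℝ η y v) fun h => hx (hds h)
  have hl : Tendsto (fun k => ∫ x, √(u x ^ 2 + δ k ^ 2) * fderiv ℝ η x v ∂μ) atTop
      (𝓝 (∫ x, |u x| * fderiv ℝ η x v ∂μ)) := by
    refine tendsto_integral_of_dominated_convergence
      (fun x => |u x * fderiv ℝ η x v| + |fderiv ℝ η x v|) (fun k => ?_) ?_
      (fun k => ae_of_all _ fun x => ?_) (ae_of_all _ fun x => ?_)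
    · refine hrestr (AEStronglyMeasurable.mul ?_ hd.aestronglyMeasurable) fun x hx => by
        simp [hd0 x hx]
      exact (show Continuous fun t : ℝ => √(t ^ 2 + δ k ^ 2) by fun_prop).comp_aestronglyMeasurable
        hum
    · exact (integrable_mul_of_tsupport_subset hu hd hdc (hds.trans hηΩ)).norm.add
        (hd.integrable_of_hasCompactSupport hdc).norm
    · rw [Real.norm_eq_abs, abs_mul, abs_of_nonneg (Real.sqrt_nonneg _), abs_mul]
      have : √(u x ^ 2 + δ k ^ 2) ≤ |u x| + 1 := by
        rw [Real.sqrt_le_left (by positivity)]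
        have := hδ k; have := hδ1 k
        nlinarith [sq_abs (u x), abs_nonneg (u x)]
      nlinarith [abs_nonneg (fderiv ℝ η x v)]
    · refine Tendsto.mul_const _ ?_
      have : Tendsto (fun k => √(u x ^ 2 + δ k ^ 2)) atTop (𝓝 √(u x ^ 2 + 0 ^ 2)) :=
        ((hδ0.pow 2).const_add _).sqrt
      simpa [Real.sqrt_sq_eq_abs] using this
  have hr : Tendsto (fun k => ∫ x, u x / √(u x ^ 2 + δ k ^ 2) * h x * η x ∂μ) atTop
      (𝓝 (∫ x, (SignType.sign (u x) : ℝ) * h x * η x ∂μ)) := by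
    refine tendsto_integral_of_dominated_convergence
      (fun x => |h x * η x|) (fun k => ?_) ?_
      (fun k => ae_of_all _ fun x => ?_) (ae_of_all _ fun x => ?_)
    · refine hrestr (AEStronglyMeasurable.mul (AEStronglyMeasurable.mul ?_ hhm)
        hη.continuous.aestronglyMeasurable) fun x hx => by simp [hη0 x hx]
      exact (show Continuous fun t : ℝ => t / √(t ^ 2 + δ k ^ 2) from continuous_id.div
        (by fun_prop) fun t => (Real.sqrt_pos.2 (hpos k t)).ne').comp_aestronglyMeasurable hum
    · exact (integrable_mul_of_tsupport_subset hh hη.continuous hηc hηΩ).norm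
    · rw [mul_assoc, norm_mul, Real.norm_eq_abs, Real.norm_eq_abs, abs_div,
        abs_of_pos (Real.sqrt_pos.2 (hpos k _))]
      refine mul_le_of_le_one_left (abs_nonneg _) ?_
      rw [div_le_one (Real.sqrt_pos.2 (hpos k _))]
      apply Real.abs_le_sqrt; nlinarith [sq_nonneg (δ k)]
    · refine (Tendsto.mul_const _ ?_).mul_const _
      rcases eq_or_ne (u x) 0 with h0 | h0
      · simp [h0]
      · have : Tendsto (fun k => u x / √(u x ^ 2 + δ k ^ 2)) atTop
            (𝓝 (u x / √(u x ^ 2 + 0 ^ 2))) :=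
          tendsto_const_nhds.div ((hδ0.pow 2).const_add _).sqrt (by simp [Real.sqrt_sq_eq_abs, h0])
        convert this using 2
        rcases lt_or_gt_of_ne h0 with h | h
        · simp [Real.sqrt_sq_eq_abs, h, abs_of_neg, h0]
        · simp [Real.sqrt_sq_eq_abs, h, abs_of_pos, h0]
  simp only [hcomp] at hl
  exact tendsto_nhds_unique hl hr.neg

theorem HasWeakDeriv.ae_unique {Ω : Set E} (hΩ : IsOpen Ω) {u h h' : E → ℝ} {v : E}
    (hh : LocallyIntegrableOn h Ω μ) (hh' : LocallyIntegrableOn h' Ω μ)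
    (hw : HasWeakDeriv μ Ω u h v) (hw' : HasWeakDeriv μ Ω u h' v) :
    ∀ᵐ x ∂μ, x ∈ Ω → h x = h' x := by
  have := hΩ.ae_eq_zero_of_integral_contDiff_smul_eq_zero (hh.sub hh') fun η hη hηc hηΩ => by
    have e := hw η hη hηc hηΩ
    have e' := hw' η hη hηc hηΩ
    have i1 := integrable_mul_of_tsupport_subset hh hη.continuous hηc hηΩ
    have i2 := integrable_mul_of_tsupport_subset hh' hη.continuous hηc hηΩ
    have : ∫ x, η x • (h - h') x ∂μ = ∫ x, h x * η x - h' x * η x ∂μ :=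
      integral_congr_ae (ae_of_all _ fun x => by simp; ring)
    rw [this, integral_sub i1 i2]
    linarith
  filter_upwards [this] with x hx hxΩ
  simpa [sub_eq_zero] using hx hxΩ

end Euclidean

/-! ### The Riemannian volume in charts: null sets, measurability, local integrability -/

theorem iSup_measure_eq_zero {α : Type*} {ι : Sort*} [MeasurableSpace α] {μ : ι → Measure α} {s : Set α}
    (hs : MeasurableSet s) (h : ∀ i, μ i s = 0) : (⨆ i, μ i) s = 0 := by
  -- The supremum is the least upper bound, and its restriction to `sᶜ` is still an upper bound
  -- because every `μ i` vanishes on `s`.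
  have hle : (⨆ i, μ i) ≤ (⨆ i, μ i).restrict sᶜ := by
    refine iSup_le fun i => Measure.le_iff.2 fun t ht => ?_
    rw [Measure.restrict_apply ht]
    calc μ i t ≤ μ i (t ∩ sᶜ) + μ i s := by
          refine (measure_mono fun x hx => ?_).trans (measure_union_le _ _)
          by_cases hxs : x ∈ s
          · exact Or.inr hxs
          · exact Or.inl ⟨hx, hxs⟩
      _ ≤ (⨆ i, μ i) (t ∩ sᶜ) := by rw [h, add_zero]; exact le_iSup μ i _
  refine le_antisymm ((hle s).trans ?_) zero_le
  rw [Measure.restrict_apply hs]; simp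

section Charts

set_option linter.unusedSectionVars false

variable {n : ℕ} {N : Type*} [TopologicalSpace N] [ChartedSpace (Model n) N]
  [IsManifold (𝓡 (n + 1)) ∞ N] {e : OpenPartialHomeomorph N (Model n)}

theorem mdifferentiable_of_mem_charts (he : e ∈ charts n N) :
    e.MDifferentiable (𝓡 (n + 1)) (𝓡 (n + 1)) :=
  ⟨(contMDiffOn_of_mem_maximalAtlas he).mdifferentiableOn (by simp),
    (contMDiffOn_symm_of_mem_maximalAtlas he).mdifferentiableOn (by simp)⟩

theorem mfderiv_symm_eq_sum (e : OpenPartialHomeomorph N (Model n)) (y z : Model n) :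
    mfderiv (𝓡 (n + 1)) (𝓡 (n + 1)) e.symm y z = ∑ i, z i • coordVec e y i := by
  have h3 : z = ∑ i, z i • (EuclideanSpace.single i (1 : ℝ) : Model n) := by
    ext j
    simp [Pi.single_apply, Finset.sum_ite_eq]
  conv_lhs => rw [h3]
  exact (map_sum (mfderiv (𝓡 (n + 1)) (𝓡 (n + 1)) e.symm y)
    (fun i => z i • (EuclideanSpace.single i (1 : ℝ) : Model n)) _).trans
    (Finset.sum_congr rfl fun i _ => (mfderiv (𝓡 (n + 1)) (𝓡 (n + 1)) e.symm y).map_smul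
      (z i) (EuclideanSpace.single i (1 : ℝ) : Model n))

theorem sum_coords_smul_coordVec (he : e ∈ charts n N)
    (X : (x : N) → TangentSpace (𝓡 (n + 1)) x) {y : Model n} (hy : y ∈ e.target) :
    ∑ i, (coords e X y) i • coordVec e y i = X (e.symm y) := by
  have h1 := (mdifferentiable_of_mem_charts he).symm_comp_deriv (e.map_target hy)
  rw [e.right_inv hy] at h1
  rw [← mfderiv_symm_eq_sum]
  exact congrArg (fun L => L (X (e.symm y))) h1

theorem contMDiffOn_coordVec (he : e ∈ charts n N) (i : Fin (n + 1)) :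
    ContMDiffOn (𝓡 (n + 1)) ((𝓡 (n + 1)).prod 𝓘(ℝ, Model n)) 0
      (fun y => (Bundle.TotalSpace.mk' (Model n) (e.symm y) (coordVec e y i) :
        TangentBundle (𝓡 (n + 1)) N)) e.target := by
  have h1 := (contMDiffOn_symm_of_mem_maximalAtlas he).contMDiffOn_tangentMapWithin (m := 0)
    (by simp) e.open_target.uniqueMDiffOn
  have h2 : ContMDiffOn (𝓡 (n + 1)) ((𝓡 (n + 1)).prod 𝓘(ℝ, Model n)) 0
      (fun y => (⟨y, (EuclideanSpace.single i (1 : ℝ) : Model n)⟩ :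
        TangentBundle (𝓡 (n + 1)) (Model n))) e.target :=
    contMDiffOn_vectorSpace_iff_contDiffOn.2 contDiffOn_const
  refine (h1.comp h2 fun y hy => hy).congr fun y hy => ?_
  simp only [Function.comp_apply, tangentMapWithin, coordVec]
  rw [mfderivWithin_of_isOpen e.open_target hy]

variable (g : SmoothMetric n N)

theorem continuousOn_inner_coordVec (he : e ∈ charts n N) (i j : Fin (n + 1)) :
    ContinuousOn (fun y => g.inner (e.symm y) (coordVec e y i) (coordVec e y j)) e.target := by
  have h0 : ContMDiffOn (𝓡 (n + 1)) ((𝓡 (n + 1)).prod 𝓘(ℝ, Model n →L[ℝ] Model n →L[ℝ] ℝ)) 0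
      (fun y => (Bundle.TotalSpace.mk' (Model n →L[ℝ] Model n →L[ℝ] ℝ)
        (E := fun x : N => TangentSpace (𝓡 (n + 1)) x →L[ℝ] TangentSpace (𝓡 (n + 1)) x →L[ℝ] ℝ)
        (e.symm y) (g.inner (e.symm y)))) e.target :=
    (g.contMDiff.of_le (by simp)).comp_contMDiffOn
      ((contMDiffOn_symm_of_mem_maximalAtlas he).of_le (by simp))
  have h1 := ContMDiffOn.clm_bundle_apply₂ (F₁ := Model n) (F₂ := Model n) (F₃ := ℝ)
    (E₁ := fun x : N => TangentSpace (𝓡 (n + 1)) x)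
    (E₂ := fun x : N => TangentSpace (𝓡 (n + 1)) x)
    (E₃ := Bundle.Trivial N ℝ) h0 (contMDiffOn_coordVec he i) (contMDiffOn_coordVec he j)
  intro y hy
  have h2 := h1 y hy
  rw [Bundle.contMDiffWithinAt_totalSpace] at h2
  exact h2.2.continuousWithinAt

theorem metric_self_nonneg (x : N) (v : TangentSpace (𝓡 (n + 1)) x) : 0 ≤ g.inner x v v := by
  rcases eq_or_ne v 0 with rfl | h
  · simp
  · exact (g.pos x v h).le

theorem two_mul_abs_metric_le (x : N) (v w : TangentSpace (𝓡 (n + 1)) x) :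
    2 * |g.inner x v w| ≤ g.inner x v v + g.inner x w w := by
  have h1 := metric_self_nonneg g x (v + w)
  have h2 := metric_self_nonneg g x (v - w)
  simp only [map_add, map_sub, add_apply, sub_apply, g.symm x w v] at h1 h2
  rcases abs_cases (g.inner x v w) with ⟨h, _⟩ | ⟨h, _⟩ <;> rw [h] <;> linarith

theorem gram_posDef (he : e ∈ charts n N) {y : Model n} (hy : y ∈ e.target) :
    (gram g e y).PosDef := by
  refine Matrix.PosDef.of_dotProduct_mulVec_pos ?_ fun c hc => ?_
  · ext i j
    simp [gram, g.symm]
  · set v : TangentSpace (𝓡 (n + 1)) (e.symm y) := ∑ i, c i • coordVec e y i with hv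
    have hvv : star c ⬝ᵥ (gram g e y).mulVec c = g.inner (e.symm y) v v := by
      simp only [hv, map_sum, map_smul, sum_apply, smul_apply, smul_eq_mul, dotProduct,
        Matrix.mulVec, gram, Matrix.of_apply, Finset.mul_sum, star_trivial]
      rw [Finset.sum_comm]
      refine Finset.sum_congr rfl fun i _ => Finset.sum_congr rfl fun j _ => ?_
      ring
    rw [hvv]
    -- The combination `∑ cᵢ ∂ᵢ` is the image of `c` under the differential of `e.symm`, which is
    -- injective since the differential of `e` inverts it.
    refine g.pos _ _ fun h0 => hc ?_
    have h1 := (mdifferentiable_of_mem_charts he).comp_symm_deriv hy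
    have h2 : mfderiv (𝓡 (n + 1)) (𝓡 (n + 1)) e.symm y (WithLp.toLp 2 c : Model n) = v := by
      rw [mfderiv_symm_eq_sum]
    have h3 := congrArg (fun L => L (WithLp.toLp 2 c : Model n)) h1
    have h4 : mfderiv (𝓡 (n + 1)) (𝓡 (n + 1)) e (e.symm y) v = (WithLp.toLp 2 c : Model n) := by
      rw [← h2]; exact h3
    rw [h0, map_zero] at h4
    ext i
    exact (congrArg (fun z : Model n => z i) h4).symm

theorem continuousOn_gram_det (he : e ∈ charts n N) :
    ContinuousOn (fun y => (gram g e y).det) e.target := by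
  have : ContinuousOn (gram g e) e.target :=
    continuousOn_pi.2 fun i => continuousOn_pi.2 fun j => continuousOn_inner_coordVec g he i j
  exact (continuous_id.matrix_det).comp_continuousOn this

theorem differentiableOn_transition {e' : OpenPartialHomeomorph N (Model n)}
    (he : e ∈ charts n N) (he' : e' ∈ charts n N) :
    DifferentiableOn ℝ (e' ∘ e.symm) (e.target ∩ e.symm ⁻¹' e'.source) := by
  have h : ContMDiffOn (𝓡 (n + 1)) (𝓡 (n + 1)) ∞ (e' ∘ e.symm)
      (e.target ∩ e.symm ⁻¹' e'.source) :=
    (contMDiffOn_of_mem_maximalAtlas he').comp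
      ((contMDiffOn_symm_of_mem_maximalAtlas he).mono inter_subset_left) fun y hy => hy.2
  exact (contMDiffOn_iff_contDiffOn.1 h).differentiableOn (by simp)

variable [MeasurableSpace N] [BorelSpace N]

omit [IsManifold (𝓡 (n + 1)) ∞ N] in
/-- A Borel map that agrees with the chart `e` on its domain. -/
theorem exists_measurable_eqOn_chart (e : OpenPartialHomeomorph N (Model n)) :
    ∃ f : N → Model n, Measurable f ∧ EqOn f e e.source := by
  classical
  exact ⟨e.source.piecewise e (fun _ => 0),
    e.continuousOn.measurable_piecewise continuousOn_const e.open_source.measurableSet,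
    piecewise_eqOn _ _ _⟩

omit [IsManifold (𝓡 (n + 1)) ∞ N] in
theorem aemeasurable_chart_symm (e : OpenPartialHomeomorph N (Model n)) (μ : Measure (Model n)) :
    AEMeasurable e.symm (μ.restrict e.target) :=
  e.continuousOn_symm.aemeasurable e.open_target.measurableSet

theorem aemeasurable_density (he : e ∈ charts n N) :
    AEMeasurable (fun y => ENNReal.ofReal (Real.sqrt (gram g e y).det))
      (volume.restrict e.target) :=
  ((continuousOn_gram_det g he).aemeasurable e.open_target.measurableSet).sqrt.ennreal_ofReal

theorem aemeasurable_symm_withDensity (e : OpenPartialHomeomorph N (Model n)) :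
    AEMeasurable e.symm ((volume.restrict e.target).withDensity
      fun y => ENNReal.ofReal (Real.sqrt (gram g e y).det)) :=
  (aemeasurable_chart_symm e volume).mono_ac (withDensity_absolutelyContinuous _ _)

theorem chartVolume_eq_zero (e : OpenPartialHomeomorph N (Model n)) {C : Set N}
    (hC : MeasurableSet C) (h0 : volume (e.target ∩ e.symm ⁻¹' C) = 0) :
    chartVolume g e C = 0 := by
  rw [chartVolume, Measure.map_apply_of_aemeasurable (aemeasurable_symm_withDensity g e) hC]
  refine withDensity_absolutelyContinuous _ _ ?_
  rw [Measure.restrict_apply' e.open_target.measurableSet, inter_comm]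
  exact h0

theorem vol_eq_zero_of_forall_chartVolume {C : Set N} (hC : MeasurableSet C)
    (h : ∀ e ∈ charts n N, chartVolume g e C = 0) : vol g C = 0 := by
  have h1 : vol g = ⨆ e, ⨆ (_ : e ∈ charts n N), chartVolume g e := rfl
  rw [h1]
  exact iSup_measure_eq_zero hC fun e => iSup_measure_eq_zero hC fun he => h e he

/-- `vol` is a supremum over all charts, so nullity in one chart must be carried to the others.
Transition maps are differentiable and hence preserve Lebesgue null sets. As `A` need not be
measurable, it is first enlarged to a Borel set `C`. -/
theorem vol_eq_zero_of_chart (he : e ∈ charts n N) {A : Set N} (hA : A ⊆ e.source)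
    (h0 : volume (e.target ∩ e.symm ⁻¹' A) = 0) : vol g A = 0 := by
  obtain ⟨f, hf, hfe⟩ := exists_measurable_eqOn_chart e
  set B := toMeasurable volume (e.target ∩ e.symm ⁻¹' A) with hB
  have hBm : MeasurableSet B := measurableSet_toMeasurable _ _
  have hB0 : volume B = 0 := by rw [hB, measure_toMeasurable, h0]
  set C := e.source ∩ f ⁻¹' B with hC
  have hCm : MeasurableSet C := e.open_source.measurableSet.inter (hf hBm)
  have hAC : A ⊆ C := by
    refine fun x hx => ⟨hA hx, subset_toMeasurable _ _ ?_⟩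
    rw [hfe (hA hx)]
    exact ⟨e.map_source (hA hx), by simpa [e.left_inv (hA hx)] using hx⟩
  refine measure_mono_null hAC ?_
  refine vol_eq_zero_of_forall_chartVolume g hCm fun e' he' => ?_
  have hsub : e'.target ∩ e'.symm ⁻¹' C ⊆
      (e' ∘ e.symm) '' (B ∩ (e.target ∩ e.symm ⁻¹' e'.source)) := by
    rintro y ⟨hy, hy1, hy2⟩
    have hy2' : e (e'.symm y) ∈ B := by rw [← hfe hy1]; exact hy2
    refine ⟨e (e'.symm y), ⟨hy2', e.map_source hy1, ?_⟩, ?_⟩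
    · simpa [e.left_inv hy1] using e'.map_target hy
    · simp [e.left_inv hy1, e'.right_inv hy]
  have hnull : volume (e'.target ∩ e'.symm ⁻¹' C) = 0 :=
    measure_mono_null hsub <| addHaar_image_eq_zero_of_differentiableOn_of_addHaar_eq_zero _
      ((differentiableOn_transition he he').mono inter_subset_right)
      (measure_mono_null inter_subset_left hB0)
  exact chartVolume_eq_zero g e' hCm hnull

theorem chartVolume_le_vol (he : e ∈ charts n N) : chartVolume g e ≤ vol g :=
  le_iSup₂ (f := fun e (_ : e ∈ charts n N) => chartVolume g e) e he

/-- The density `√det g_ij` is strictly positive on the chart, so a null set for the weighted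
measure is Lebesgue null. -/
theorem chart_null_of_vol_eq_zero (he : e ∈ charts n N) {A : Set N} (h0 : vol g A = 0) :
    volume (e.target ∩ e.symm ⁻¹' A) = 0 := by
  have h1 : chartVolume g e A = 0 := le_antisymm ((chartVolume_le_vol g he A).trans h0.le) zero_le
  have h2 := Measure.preimage_null_of_map_null (aemeasurable_symm_withDensity g e) h1
  rw [withDensity_apply_eq_zero' (aemeasurable_density g he),
    Measure.restrict_apply' e.open_target.measurableSet] at h2
  refine measure_mono_null ?_ h2
  rintro y ⟨hy, hyA⟩
  refine ⟨⟨?_, hyA⟩, hy⟩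
  simpa using (gram_posDef g he hy).det_pos

theorem map_chart_symm_absolutelyContinuous (he : e ∈ charts n N) :
    (volume.restrict e.target).map e.symm ≪ vol g := by
  refine Measure.AbsolutelyContinuous.mk fun s hs h0 => ?_
  rw [Measure.map_apply_of_aemeasurable (aemeasurable_chart_symm e volume) hs,
    Measure.restrict_apply' e.open_target.measurableSet, inter_comm]
  exact chart_null_of_vol_eq_zero g he h0

theorem ae_chart_of_ae_vol (he : e ∈ charts n N) {p : N → Prop} (h : ∀ᵐ x ∂(vol g), p x) :
    ∀ᵐ y ∂(volume.restrict e.target), p (e.symm y) := by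
  rw [ae_restrict_iff' e.open_target.measurableSet]
  have := chart_null_of_vol_eq_zero g he (ae_iff.1 h)
  rw [ae_iff]
  convert this using 2
  ext y
  simp

variable [CompactSpace N]

/-- Countably many charts cover `N`, so the exceptional set is a countable union of sets each null
in one chart. -/
theorem ae_vol_of_ae_charts {p : N → Prop}
    (h : ∀ e ∈ charts n N, ∀ᵐ y ∂(volume.restrict e.target), p (e.symm y)) :
    ∀ᵐ x ∂(vol g), p x := by
  obtain ⟨s, hs, hcov⟩ := countable_cover_nhds_of_sigmaCompact
    fun x : N => chart_source_mem_nhds (Model n) x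
  have h1 : ∀ᵐ x ∂(vol g), ∀ z ∈ s, x ∈ (chartAt (Model n) z).source → p x := by
    rw [ae_ball_iff hs]
    intro z _
    have hz : chartAt (Model n) z ∈ charts n N := IsManifold.chart_mem_maximalAtlas z
    have := h _ hz
    rw [ae_restrict_iff' (chartAt (Model n) z).open_target.measurableSet, ae_iff] at this
    rw [ae_iff]
    refine vol_eq_zero_of_chart g hz (fun x hx => ?_) (measure_mono_null ?_ this)
    · simp only [mem_ofPred_eq, Classical.not_imp] at hx
      exact hx.1
    · rintro y ⟨hy, hy2⟩
      simp only [mem_preimage, mem_ofPred_eq, Classical.not_imp] at hy2 ⊢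
      exact ⟨hy, hy2.2⟩
  filter_upwards [h1] with x hx
  have : x ∈ ⋃ z ∈ s, (chartAt (Model n) z).source := by rw [hcov]; trivial
  simp only [mem_iUnion] at this
  obtain ⟨z, hz, hxz⟩ := this
  exact hx z hz hxz

theorem aemeasurable_of_charts {f : N → ℝ}
    (h : ∀ e ∈ charts n N, AEMeasurable (fun y => f (e.symm y)) (volume.restrict e.target)) :
    AEMeasurable f (vol g) := by
  obtain ⟨s, hs, hcov⟩ := countable_cover_nhds_of_sigmaCompact
    fun x : N => chart_source_mem_nhds (Model n) x
  have : Countable s := hs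
  rw [← Measure.restrict_univ (μ := vol g), ← hcov, biUnion_eq_iUnion]
  refine (aemeasurable_iUnion_iff).2 fun z => ?_
  set e := chartAt (Model n) (z : N)
  have he : e ∈ charts n N := IsManifold.chart_mem_maximalAtlas _
  obtain ⟨F, hF, hFe⟩ := exists_measurable_eqOn_chart e
  obtain ⟨G, hG, hfG⟩ := h e he
  refine ⟨fun x => G (F x), hG.comp hF, ?_⟩
  rw [Filter.EventuallyEq, ae_restrict_iff' e.open_target.measurableSet, ae_iff] at hfG
  rw [Filter.EventuallyEq, ae_restrict_iff' e.open_source.measurableSet, ae_iff]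
  refine vol_eq_zero_of_chart g he (fun x hx => ?_) (measure_mono_null ?_ hfG)
  · simp only [mem_ofPred_eq, Classical.not_imp] at hx
    exact hx.1
  · rintro y ⟨hy, hy2⟩
    simp only [mem_preimage, mem_ofPred_eq, Classical.not_imp] at hy2 ⊢
    rw [hFe hy2.1, e.right_inv hy] at hy2
    exact ⟨hy, hy2.2⟩

omit [CompactSpace N]

theorem aestronglyMeasurable_comp_chart_symm (he : e ∈ charts n N) {f : N → ℝ}
    (hf : AEStronglyMeasurable f (vol g)) :
    AEStronglyMeasurable (fun y => f (e.symm y)) (volume.restrict e.target) :=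
  (hf.mono_ac (map_chart_symm_absolutelyContinuous g he)).comp_aemeasurable
    (aemeasurable_chart_symm e volume)

/-- Integrals over compact subsets of a chart are controlled by the Riemannian volume. -/
theorem lintegral_compact_chart_lt_top (he : e ∈ charts n N) {f : N → ℝ≥0∞}
    (hf : AEMeasurable f (vol g)) (hfin : ∫⁻ x, f x ∂(vol g) < ⊤) {K : Set (Model n)}
    (hK : IsCompact K) (hKe : K ⊆ e.target) : ∫⁻ y in K, f (e.symm y) < ⊤ := by
  rcases K.eq_empty_or_nonempty with rfl | hKn
  · simp
  -- On `K` the density `√det g_ij` has a positive minimum `c`, so Lebesgue measure there is at most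
  -- `1/c` times the volume.
  obtain ⟨y₀, hy₀, hmin⟩ := hK.exists_isMinOn hKn
    (((continuousOn_gram_det g he).mono hKe).sqrt)
  set c := Real.sqrt (gram g e y₀).det with hc
  have hc0 : 0 < c := Real.sqrt_pos.2 (gram_posDef g he (hKe hy₀)).det_pos
  have hfe : AEMeasurable (fun y => f (e.symm y)) (volume.restrict e.target) :=
    (hf.mono_ac (map_chart_symm_absolutelyContinuous g he)).comp_aemeasurable
      (aemeasurable_chart_symm e volume)
  have hle : ENNReal.ofReal c * ∫⁻ y in K, f (e.symm y) ≤ ∫⁻ x, f x ∂(vol g) :=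
    calc ENNReal.ofReal c * ∫⁻ y in K, f (e.symm y)
        = ∫⁻ y in K, ENNReal.ofReal c * f (e.symm y) :=
          (lintegral_const_mul' _ _ ENNReal.ofReal_ne_top).symm
      _ ≤ ∫⁻ y in K, ENNReal.ofReal (Real.sqrt (gram g e y).det) * f (e.symm y) := by
          refine setLIntegral_mono_ae' hK.measurableSet (ae_of_all _ fun y hy => ?_)
          gcongr
          exact hmin hy
      _ ≤ ∫⁻ y in e.target, ENNReal.ofReal (Real.sqrt (gram g e y).det) * f (e.symm y) :=
          lintegral_mono_set hKe
      _ = ∫⁻ y, f (e.symm y) ∂((volume.restrict e.target).withDensity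
            fun y => ENNReal.ofReal (Real.sqrt (gram g e y).det)) :=
          (lintegral_withDensity_eq_lintegral_mul₀ (aemeasurable_density g he) hfe).symm
      _ = ∫⁻ x, f x ∂(chartVolume g e) := by
          rw [chartVolume, lintegral_map' ?_ (aemeasurable_symm_withDensity g e)]
          exact hf.mono_measure (chartVolume_le_vol g he)
      _ ≤ ∫⁻ x, f x ∂(vol g) := lintegral_mono' (chartVolume_le_vol g he) le_rfl
  by_contra htop
  rw [not_lt, top_le_iff] at htop
  rw [htop, ENNReal.mul_top (by simpa using hc0)] at hle
  exact absurd hfin (not_lt.2 hle)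

/-- A function dominated, in the chart `e`, by the sum of a function of finite integral and a
continuous function is locally integrable. -/
theorem locallyIntegrableOn_chart (he : e ∈ charts n N) {f : N → ℝ}
    (hf : AEMeasurable f (vol g)) (hfin : ∫⁻ x, ENNReal.ofReal (f x) ∂(vol g) < ⊤)
    {k b : Model n → ℝ} (hk : AEStronglyMeasurable k (volume.restrict e.target))
    (hb : ContinuousOn b e.target) (hkb : ∀ y ∈ e.target, |k y| ≤ f (e.symm y) + b y) :
    LocallyIntegrableOn k e.target := by
  rw [locallyIntegrableOn_iff e.open_target.isLocallyClosed]
  intro K hKe hK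
  refine ⟨hk.mono_set hKe, ?_⟩
  have h1 := lintegral_compact_chart_lt_top g he hf.ennreal_ofReal hfin hK hKe
  have h2 : ∫⁻ y in K, ‖b y‖ₑ < ⊤ := ((hb.mono hKe).integrableOn_compact hK).2
  have hbm : AEMeasurable (fun y => ‖b y‖ₑ) (volume.restrict K) :=
    ((hb.mono hKe).aemeasurable hK.measurableSet).enorm
  refine lt_of_le_of_lt ?_ (ENNReal.add_lt_top.2 ⟨h1, h2⟩)
  rw [← lintegral_add_right' _ hbm]
  refine setLIntegral_mono_ae' hK.measurableSet (ae_of_all _ fun y hy => ?_)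
  rw [Real.enorm_eq_ofReal_abs, Real.enorm_eq_ofReal_abs]
  refine (ENNReal.ofReal_le_ofReal ((hkb y (hKe hy)).trans ?_)).trans ENNReal.ofReal_add_le
  gcongr
  exact le_abs_self _

theorem aestronglyMeasurable_inner_coordVec (he : e ∈ charts n N)
    {X : (x : N) → TangentSpace (𝓡 (n + 1)) x}
    (hX : AEStronglyMeasurable (coords e X) (volume.restrict e.target)) (i : Fin (n + 1)) :
    AEStronglyMeasurable (fun y => g.inner (e.symm y) (X (e.symm y)) (coordVec e y i))
      (volume.restrict e.target) := by
  have h1 : AEStronglyMeasurable (fun y => ∑ k, coords e X y k *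
      g.inner (e.symm y) (coordVec e y k) (coordVec e y i)) (volume.restrict e.target) := by
    refine Finset.aestronglyMeasurable_fun_sum _ fun k _ => ?_
    refine AEStronglyMeasurable.mul ?_ ((continuousOn_inner_coordVec g he k i).aestronglyMeasurable
      e.open_target.measurableSet)
    exact (show Continuous fun z : Model n => z k by fun_prop).comp_aestronglyMeasurable hX
  refine h1.congr ((ae_restrict_iff' e.open_target.measurableSet).2 (ae_of_all _ fun y hy => ?_))
  simp only
  conv_rhs => rw [← sum_coords_smul_coordVec he X hy]
  simp only [map_sum, map_smul, sum_apply, smul_apply, smul_eq_mul]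

theorem aestronglyMeasurable_metric_chart (he : e ∈ charts n N)
    {X : (x : N) → TangentSpace (𝓡 (n + 1)) x}
    (hX : AEStronglyMeasurable (coords e X) (volume.restrict e.target)) :
    AEStronglyMeasurable (fun y => g.inner (e.symm y) (X (e.symm y)) (X (e.symm y)))
      (volume.restrict e.target) := by
  have h1 : AEStronglyMeasurable (fun y => ∑ k, coords e X y k *
      g.inner (e.symm y) (X (e.symm y)) (coordVec e y k)) (volume.restrict e.target) := by
    refine Finset.aestronglyMeasurable_fun_sum _ fun k _ => ?_
    refine AEStronglyMeasurable.mul ?_ (aestronglyMeasurable_inner_coordVec g he hX k)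
    exact (show Continuous fun z : Model n => z k by fun_prop).comp_aestronglyMeasurable hX
  refine h1.congr ((ae_restrict_iff' e.open_target.measurableSet).2 (ae_of_all _ fun y hy => ?_))
  simp only
  have h2 := congrArg (fun w => g.inner (e.symm y) (X (e.symm y)) w)
    (sum_coords_smul_coordVec he X hy)
  simp only [map_sum, map_smul, smul_eq_mul] at h2
  exact h2

theorem aemeasurable_metric [CompactSpace N] {X : (x : N) → TangentSpace (𝓡 (n + 1)) x}
    (hX : ∀ e ∈ charts n N, AEStronglyMeasurable (coords e X) (volume.restrict e.target)) :
    AEMeasurable (fun x => g.inner x (X x) (X x)) (vol g) :=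
  aemeasurable_of_charts g fun e he =>
    (aestronglyMeasurable_metric_chart g he (hX e he)).aemeasurable

theorem locallyIntegrableOn_inner_coordVec [CompactSpace N] (he : e ∈ charts n N)
    {X : (x : N) → TangentSpace (𝓡 (n + 1)) x}
    (hX : ∀ e ∈ charts n N, AEStronglyMeasurable (coords e X) (volume.restrict e.target))
    (hfin : ∫⁻ x, ENNReal.ofReal (g.inner x (X x) (X x)) ∂(vol g) < ⊤) (i : Fin (n + 1)) :
    LocallyIntegrableOn (fun y => g.inner (e.symm y) (X (e.symm y)) (coordVec e y i)) e.target := by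
  refine locallyIntegrableOn_chart g he (aemeasurable_metric g hX) hfin
    (aestronglyMeasurable_inner_coordVec g he (hX e he) i) (continuousOn_inner_coordVec g he i i)
    fun y _ => ?_
  have := two_mul_abs_metric_le g (e.symm y) (X (e.symm y)) (coordVec e y i)
  linarith [abs_nonneg (g.inner (e.symm y) (X (e.symm y)) (coordVec e y i))]

theorem locallyIntegrableOn_comp_chart_symm (he : e ∈ charts n N) {u : N → ℝ}
    (hu : MemLp u 2 (vol g)) : LocallyIntegrableOn (fun y => u (e.symm y)) e.target := by
  refine locallyIntegrableOn_chart g he (f := fun x => u x ^ 2) (b := fun _ => 1)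
    (hu.1.aemeasurable.pow_const 2) ?_ (aestronglyMeasurable_comp_chart_symm g he hu.1)
    continuousOn_const fun y _ => ?_
  · have := hu.integrable_sq
    have h2 := this.2
    refine lt_of_le_of_lt (lintegral_mono fun x => ?_) h2
    rw [Real.enorm_eq_ofReal_abs]
    exact ENNReal.ofReal_le_ofReal (le_abs_self _)
  · rcases abs_cases (u (e.symm y)) with ⟨h, _⟩ | ⟨h, _⟩ <;> rw [h] <;>
      nlinarith [sq_nonneg (u (e.symm y) - 1), sq_nonneg (u (e.symm y) + 1)]

end Charts

/-! ### Gradients on the manifold: uniqueness, linear combinations, absolute value -/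

theorem measurable_coe_sign : Measurable fun t : ℝ => (SignType.sign t : ℝ) := by
  have : (fun t : ℝ => (SignType.sign t : ℝ)) =
      fun t => if 0 < t then 1 else if t < 0 then -1 else 0 := by
    ext t
    rcases lt_trichotomy t 0 with h | h | h
    · simp [h, h.le.not_gt]
    · simp [h]
    · simp [h]
  rw [this]
  exact Measurable.ite measurableSet_Ioi measurable_const
    (Measurable.ite measurableSet_Iio measurable_const measurable_const)

section Gradient

set_option linter.unusedSectionVars false

variable {n : ℕ} {N : Type*} [TopologicalSpace N] [ChartedSpace (Model n) N]
  [IsManifold (𝓡 (n + 1)) ∞ N] {e : OpenPartialHomeomorph N (Model n)}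
  {g : SmoothMetric n N}

theorem metric_lin (x : N) (a b : ℝ) (v w : TangentSpace (𝓡 (n + 1)) x) :
    g.inner x (a • v + b • w) (a • v + b • w) =
      a ^ 2 * g.inner x v v + 2 * a * b * g.inner x v w + b ^ 2 * g.inner x w w := by
  simp only [map_add, map_smul, add_apply, smul_apply, smul_eq_mul, g.symm x w v]
  ring

theorem metric_lin_le (x : N) (a b : ℝ) (v w : TangentSpace (𝓡 (n + 1)) x) :
    g.inner x (a • v + b • w) (a • v + b • w) ≤
      2 * a ^ 2 * g.inner x v v + 2 * b ^ 2 * g.inner x w w := by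
  have h1 := metric_self_nonneg g x (a • v + (-b) • w)
  rw [metric_lin] at h1 ⊢
  nlinarith

variable [MeasurableSpace N] [BorelSpace N]

theorem IsWeakGradient.hasWeakDeriv {u : N → ℝ} {X : (x : N) → TangentSpace (𝓡 (n + 1)) x}
    (h : IsWeakGradient g u X) (he : e ∈ charts n N) (i : Fin (n + 1)) :
    HasWeakDeriv volume e.target (fun y => u (e.symm y))
      (fun y => g.inner (e.symm y) (X (e.symm y)) (coordVec e y i))
      (EuclideanSpace.single i (1 : ℝ)) :=
  fun η hη hηc hηs => h.integral_eq e he η hη hηc hηs i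

theorem IsWeakGradient.congr {u u' : N → ℝ} {X : (x : N) → TangentSpace (𝓡 (n + 1)) x}
    (h : IsWeakGradient g u X) (huu' : u =ᵐ[vol g] u') : IsWeakGradient g u' X := by
  refine ⟨h.measurable_coords, fun e he η hη hηc hηs i => ?_⟩
  rw [← h.integral_eq e he η hη hηc hηs i]
  have h1 := ae_chart_of_ae_vol g he huu'
  rw [ae_restrict_iff' e.open_target.measurableSet] at h1
  refine integral_congr_ae ?_
  filter_upwards [h1] with y hy
  by_cases hyt : y ∈ e.target
  · rw [hy hyt]
  · have : fderiv ℝ η y (EuclideanSpace.single i (1 : ℝ)) = 0 :=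
      image_eq_zero_of_notMem_tsupport (f := fun y => fderiv ℝ η y (EuclideanSpace.single i (1 : ℝ)))
        fun hh => hyt (hηs (tsupport_fderiv_apply_subset_tsupport η _ hh))
    simp [this]

/-- `X` is the distributional gradient of `u`, and is square integrable. -/
structure IsL2Gradient (g : SmoothMetric n N) (u : N → ℝ)
    (X : (x : N) → TangentSpace (𝓡 (n + 1)) x) : Prop where
  weak : IsWeakGradient g u X
  finite : ∫⁻ x, ENNReal.ofReal (g.inner x (X x) (X x)) ∂(vol g) < ⊤

variable [CompactSpace N]

/-- In a chart the weak derivatives determine every `g(X, ∂ᵢ)`, so `X - Y` is orthogonal to a basis,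
hence to itself. This gives meaning to the arbitrary choice in `H1.grad`: any gradient computed by
hand agrees with it almost everywhere. -/
theorem IsL2Gradient.ae_unique {u : N → ℝ} {X Y : (x : N) → TangentSpace (𝓡 (n + 1)) x}
    (hX : IsL2Gradient g u X) (hY : IsL2Gradient g u Y) : ∀ᵐ x ∂(vol g), X x = Y x := by
  refine ae_vol_of_ae_charts g fun e he => ?_
  have h1 : ∀ i, ∀ᵐ y ∂(volume : Measure (Model n)), y ∈ e.target →
      g.inner (e.symm y) (X (e.symm y)) (coordVec e y i) =
      g.inner (e.symm y) (Y (e.symm y)) (coordVec e y i) := fun i =>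
    (hX.weak.hasWeakDeriv he i).ae_unique e.open_target
      (locallyIntegrableOn_inner_coordVec g he hX.weak.measurable_coords hX.finite i)
      (locallyIntegrableOn_inner_coordVec g he hY.weak.measurable_coords hY.finite i)
      (hY.weak.hasWeakDeriv he i)
  rw [ae_restrict_iff' e.open_target.measurableSet]
  filter_upwards [ae_all_iff.2 h1] with y hy hyt
  rw [← sub_eq_zero]
  by_contra hne
  refine (g.pos (e.symm y) _ hne).ne' ?_
  have h2 := sum_coords_smul_coordVec he (fun x => X x - Y x) hyt
  have h3 := congrArg (fun w => g.inner (e.symm y) (X (e.symm y) - Y (e.symm y)) w) h2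
  simp only [map_sum, map_smul, smul_eq_mul] at h3
  rw [← h3]
  refine Finset.sum_eq_zero fun i _ => ?_
  simp only [map_sub, sub_apply, hy i hyt, sub_self, mul_zero]

theorem IsL2Gradient.lin {u v : N → ℝ} {X Y : (x : N) → TangentSpace (𝓡 (n + 1)) x}
    (hu : MemLp u 2 (vol g)) (hv : MemLp v 2 (vol g))
    (hX : IsL2Gradient g u X) (hY : IsL2Gradient g v Y) (a b : ℝ) :
    IsL2Gradient g (fun x => a * u x + b * v x) (fun x => a • X x + b • Y x) := by
  refine ⟨⟨fun e he => ?_, fun e he η hη hηc hηs i => ?_⟩, ?_⟩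
  · have h1 := ((hX.weak.measurable_coords e he).const_smul a).add
      ((hY.weak.measurable_coords e he).const_smul b)
    refine h1.congr (ae_of_all _ fun y => ?_)
    simp only [coords, Pi.add_apply, Pi.smul_apply]
    exact (((mfderiv (𝓡 (n + 1)) (𝓡 (n + 1)) e (e.symm y)).map_add _ _).trans
      (congrArg₂ _ ((mfderiv (𝓡 (n + 1)) (𝓡 (n + 1)) e (e.symm y)).map_smul _ _)
        ((mfderiv (𝓡 (n + 1)) (𝓡 (n + 1)) e (e.symm y)).map_smul _ _))).symm
  · have hd : Continuous (fun y => fderiv ℝ η y (EuclideanSpace.single i (1 : ℝ))) :=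
      (hη.continuous_fderiv (by simp)).clm_apply continuous_const
    have hds := tsupport_fderiv_apply_subset_tsupport η (EuclideanSpace.single i (1 : ℝ))
    have hdc : HasCompactSupport (fun y => fderiv ℝ η y (EuclideanSpace.single i (1 : ℝ))) :=
      hηc.mono' ((subset_tsupport _).trans hds)
    have i1 := integrable_mul_of_tsupport_subset (locallyIntegrableOn_comp_chart_symm g he hu)
      hd hdc (hds.trans hηs)
    have i2 := integrable_mul_of_tsupport_subset (locallyIntegrableOn_comp_chart_symm g he hv)
      hd hdc (hds.trans hηs)
    have i3 := integrable_mul_of_tsupport_subset (locallyIntegrableOn_inner_coordVec g he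
      hX.weak.measurable_coords hX.finite i) hη.continuous hηc hηs
    have i4 := integrable_mul_of_tsupport_subset (locallyIntegrableOn_inner_coordVec g he
      hY.weak.measurable_coords hY.finite i) hη.continuous hηc hηs
    have e1 := hX.weak.integral_eq e he η hη hηc hηs i
    have e2 := hY.weak.integral_eq e he η hη hηc hηs i
    simp only [map_add, map_smul, add_apply, smul_apply, smul_eq_mul, add_mul, mul_assoc]
    rw [integral_add (i1.const_mul a) (i2.const_mul b), integral_add (i3.const_mul a)
      (i4.const_mul b)]
    simp only [integral_const_mul, e1, e2]
    ring
  · have hm := ((aemeasurable_metric g hX.weak.measurable_coords).const_mul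
      (2 * a ^ 2)).ennreal_ofReal
    calc _ ≤ ∫⁻ x, (ENNReal.ofReal (2 * a ^ 2 * g.inner x (X x) (X x)) +
          ENNReal.ofReal (2 * b ^ 2 * g.inner x (Y x) (Y x))) ∂(vol g) :=
        lintegral_mono fun x => (ENNReal.ofReal_le_ofReal (metric_lin_le x a b _ _)).trans
          ENNReal.ofReal_add_le
      _ = ENNReal.ofReal (2 * a ^ 2) * ∫⁻ x, ENNReal.ofReal (g.inner x (X x) (X x)) ∂(vol g) +
          ENNReal.ofReal (2 * b ^ 2) * ∫⁻ x, ENNReal.ofReal (g.inner x (Y x) (Y x)) ∂(vol g) := by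
        rw [lintegral_add_left' hm, ← lintegral_const_mul' _ _ ENNReal.ofReal_ne_top,
          ← lintegral_const_mul' _ _ ENNReal.ofReal_ne_top]
        simp_rw [ENNReal.ofReal_mul (show 0 ≤ 2 * a ^ 2 by positivity),
          ENNReal.ofReal_mul (show 0 ≤ 2 * b ^ 2 by positivity)]
      _ < ⊤ := ENNReal.add_lt_top.2 ⟨ENNReal.mul_lt_top ENNReal.ofReal_lt_top hX.finite,
        ENNReal.mul_lt_top ENNReal.ofReal_lt_top hY.finite⟩

theorem IsL2Gradient.abs {u : N → ℝ} {X : (x : N) → TangentSpace (𝓡 (n + 1)) x}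
    (hu : MemLp u 2 (vol g)) (hX : IsL2Gradient g u X) :
    IsL2Gradient g (fun x => |u x|) (fun x => (SignType.sign (u x) : ℝ) • X x) := by
  refine ⟨⟨fun e he => ?_, fun e he η hη hηc hηs i => ?_⟩, ?_⟩
  · have hs : AEStronglyMeasurable (fun y => (SignType.sign (u (e.symm y)) : ℝ))
        (volume.restrict e.target) :=
      (measurable_coe_sign.comp_aemeasurable
        (aestronglyMeasurable_comp_chart_symm g he hu.1).aemeasurable).aestronglyMeasurable
    refine (hs.smul (hX.weak.measurable_coords e he)).congr (ae_of_all _ fun y => ?_)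
    exact ((mfderiv (𝓡 (n + 1)) (𝓡 (n + 1)) e (e.symm y)).map_smul _ _).symm
  · have := (hX.weak.hasWeakDeriv he i).abs e.open_target
      (locallyIntegrableOn_comp_chart_symm g he hu) (locallyIntegrableOn_inner_coordVec g he
      hX.weak.measurable_coords hX.finite i) η hη hηc hηs
    simpa only [map_smul, smul_apply, smul_eq_mul] using this
  · refine lt_of_le_of_lt (lintegral_mono fun x => ENNReal.ofReal_le_ofReal ?_) hX.finite
    simp only [map_smul, smul_apply, smul_eq_mul]
    have h0 := metric_self_nonneg g x (X x)
    rcases lt_trichotomy (u x) 0 with h | h | h <;> simp [h, h0]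

namespace H1

theorem memLp (u : H1 g) : MemLp u 2 (vol g) := Lp.memLp u.1

theorem isL2Gradient (u : H1 g) : IsL2Gradient g u u.grad :=
  ⟨u.2.choose_spec.1, u.2.choose_spec.2⟩

theorem grad_ae_eq (p : H1 g) {u : N → ℝ} {X : (x : N) → TangentSpace (𝓡 (n + 1)) x}
    (hp : p =ᵐ[vol g] u) (hX : IsL2Gradient g u X) : ∀ᵐ x ∂(vol g), p.grad x = X x :=
  p.isL2Gradient.ae_unique ⟨hX.weak.congr hp.symm, hX.finite⟩

theorem ext_ae {u v : H1 g} (h : u =ᵐ[vol g] v) : u = v := Subtype.ext (Lp.ext h)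

/-- The element of `H¹(N)` defined by a function with its gradient. -/
def mk (u : N → ℝ) (hu : MemLp u 2 (vol g)) (X : (x : N) → TangentSpace (𝓡 (n + 1)) x)
    (hX : IsL2Gradient g u X) : H1 g :=
  ⟨hu.toLp u, X, hX.weak.congr hu.coeFn_toLp.symm, hX.finite⟩

theorem coe_mk {u : N → ℝ} (hu : MemLp u 2 (vol g)) {X : (x : N) → TangentSpace (𝓡 (n + 1)) x}
    (hX : IsL2Gradient g u X) : mk u hu X hX =ᵐ[vol g] u := hu.coeFn_toLp

theorem grad_mk {u : N → ℝ} (hu : MemLp u 2 (vol g)) {X : (x : N) → TangentSpace (𝓡 (n + 1)) x}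
    (hX : IsL2Gradient g u X) : ∀ᵐ x ∂(vol g), (mk u hu X hX).grad x = X x :=
  grad_ae_eq _ (coe_mk hu hX) hX

/-- The linear combination `a u + b v`. -/
def lin (a b : ℝ) (u v : H1 g) : H1 g :=
  mk (fun x => a * u x + b * v x) ((u.memLp.const_mul a).add (v.memLp.const_mul b)) _
    (u.isL2Gradient.lin u.memLp v.memLp v.isL2Gradient a b)

theorem coe_lin (a b : ℝ) (u v : H1 g) : ∀ᵐ x ∂(vol g), lin a b u v x = a * u x + b * v x :=
  coe_mk _ _

theorem grad_lin (a b : ℝ) (u v : H1 g) :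
    ∀ᵐ x ∂(vol g), (lin a b u v).grad x = a • u.grad x + b • v.grad x :=
  grad_mk _ _

/-- The absolute value of an element of `H¹(N)`. -/
def abs (u : H1 g) : H1 g :=
  mk (fun x => |u x|) u.memLp.abs _ (u.isL2Gradient.abs u.memLp)

theorem coe_abs (u : H1 g) : ∀ᵐ x ∂(vol g), abs u x = |u x| := coe_mk _ _

theorem grad_abs (u : H1 g) :
    ∀ᵐ x ∂(vol g), (abs u).grad x = (SignType.sign (u x) : ℝ) • u.grad x := grad_mk _ _

/-- The gradient vanishes almost everywhere on the zero set. -/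
theorem grad_eq_zero_of_eq_zero (u : H1 g) : ∀ᵐ x ∂(vol g), u x = 0 → u.grad x = 0 := by
  -- The positive part `w = (u + |u|)/2` equals `|w|`, so `∇w = sign(w) ∇w`. Where `u = 0` the right
  -- side vanishes, while `∇w = ∇u / 2` there.
  have h : abs (lin (1 / 2) (1 / 2) u (abs u)) = lin (1 / 2) (1 / 2) u (abs u) := by
    refine ext_ae ?_
    filter_upwards [coe_abs (lin (1 / 2) (1 / 2) u (abs u)), coe_lin (1 / 2) (1 / 2) u (abs u),
      coe_abs u] with x h1 h2 h3
    rw [h1, h2, h3, abs_of_nonneg]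
    linarith [neg_abs_le (u x)]
  have h4 := grad_abs (lin (1 / 2) (1 / 2) u (abs u))
  rw [h] at h4
  filter_upwards [h4, coe_lin (1 / 2) (1 / 2) u (abs u), coe_abs u, grad_abs u,
    grad_lin (1 / 2) (1 / 2) u (abs u)] with x h4 h1 h2 h3 h5 h0
  rw [h1, h2, h5, h3, h0] at h4
  simpa using h4

theorem aemeasurable_metric_grad_lin (u v : H1 g) (a b : ℝ) :
    AEMeasurable (fun x => g.inner x (a • u.grad x + b • v.grad x) (a • u.grad x + b • v.grad x))
      (vol g) :=
  aemeasurable_metric g (u.isL2Gradient.lin u.memLp v.memLp v.isL2Gradient a b).weak.measurable_coords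

theorem aemeasurable_metric_grad (u : H1 g) :
    AEMeasurable (fun x => g.inner x (u.grad x) (u.grad x)) (vol g) :=
  aemeasurable_metric g u.isL2Gradient.weak.measurable_coords

theorem aemeasurable_metric_grad_sub (u v : H1 g) :
    AEMeasurable (fun x => g.inner x (u.grad x - v.grad x) (u.grad x - v.grad x)) (vol g) := by
  have := aemeasurable_metric_grad_lin u v 1 (-1)
  simpa [sub_eq_add_neg] using this

end H1

end Gradient

/-! ### The `H¹` distance and the lattice operations -/

section Distance

set_option linter.unusedSectionVars false

variable {n : ℕ} {N : Type*} [TopologicalSpace N] [ChartedSpace (Model n) N]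
  [IsManifold (𝓡 (n + 1)) ∞ N] {g : SmoothMetric n N}
  [MeasurableSpace N] [BorelSpace N] [CompactSpace N]

theorem metric_sub_comm (x : N) (v w : TangentSpace (𝓡 (n + 1)) x) :
    g.inner x (v - w) (v - w) = g.inner x (w - v) (w - v) := by
  simp only [map_sub, sub_apply]; ring

namespace H1

/-- The squared distance `∫ |u - v|² + |∇u - ∇v|²`. -/
def sqDist (u v : H1 g) : ℝ≥0∞ :=
  ∫⁻ x, ENNReal.ofReal ((u x - v x) ^ 2 +
    g.inner x (u.grad x - v.grad x) (u.grad x - v.grad x)) ∂(vol g)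

theorem sqDist_comm (u v : H1 g) : sqDist u v = sqDist v u := by
  refine lintegral_congr fun x => ?_
  rw [metric_sub_comm, sub_sq_comm]

theorem sqDist_self (u : H1 g) : sqDist u u = 0 := by
  simp [sqDist]

theorem sqDist_integrand_nonneg (u v : H1 g) (x : N) : 0 ≤ (u x - v x) ^ 2 +
    g.inner x (u.grad x - v.grad x) (u.grad x - v.grad x) :=
  add_nonneg (sq_nonneg _) (metric_self_nonneg g _ _)

theorem aemeasurable_sqDist (u v : H1 g) : AEMeasurable (fun x => (u x - v x) ^ 2 +
    g.inner x (u.grad x - v.grad x) (u.grad x - v.grad x)) (vol g) :=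
  ((u.memLp.1.aemeasurable.sub v.memLp.1.aemeasurable).pow_const 2).add
    (aemeasurable_metric_grad_sub u v)

theorem sqDist_lt_top (u v : H1 g) : sqDist u v < ⊤ := by
  have hm : AEMeasurable (fun x => ENNReal.ofReal ((u x - v x) ^ 2)) (vol g) :=
    ((u.memLp.1.aemeasurable.sub v.memLp.1.aemeasurable).pow_const 2).ennreal_ofReal
  refine lt_of_le_of_lt (lintegral_mono fun x => ENNReal.ofReal_add_le) ?_
  rw [lintegral_add_left' hm, ENNReal.add_lt_top]
  constructor
  · refine lt_of_le_of_lt (lintegral_mono fun x => ?_) (u.memLp.sub v.memLp).integrable_sq.2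
    rw [Real.enorm_eq_ofReal_abs]
    exact ENNReal.ofReal_le_ofReal (le_abs_self _)
  · have := (u.isL2Gradient.lin u.memLp v.memLp v.isL2Gradient 1 (-1)).finite
    simpa [sub_eq_add_neg] using this

theorem continuousPath_iff {φ : unitInterval → H1 g} :
    ContinuousPath φ ↔ ∀ t, Tendsto (fun s => sqDist (φ s) (φ t)) (𝓝 t) (𝓝 0) := by
  refine forall_congr' fun t => ⟨fun h => ?_, fun h => ?_⟩
  · have h2 := ((ENNReal.continuous_rpow_const (y := 2)).tendsto 0).comp h
    simp only [ENNReal.zero_rpow_of_pos zero_lt_two] at h2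
    refine h2.congr fun s => ?_
    simp only [Function.comp_apply, normDist, sqDist]
    rw [← ENNReal.rpow_mul, one_div, inv_mul_cancel₀ two_ne_zero, ENNReal.rpow_one]
  · have h2 := ((ENNReal.continuous_rpow_const (y := 1 / 2)).tendsto 0).comp h
    rw [ENNReal.zero_rpow_of_pos (by norm_num)] at h2
    exact h2

theorem sqDist_lin_le (a b : ℝ) (u v u' v' : H1 g) : sqDist (lin a b u v) (lin a b u' v') ≤
    ENNReal.ofReal (2 * a ^ 2) * sqDist u u' + ENNReal.ofReal (2 * b ^ 2) * sqDist v v' := by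
  have ha : 0 ≤ 2 * a ^ 2 := by positivity
  have hb : 0 ≤ 2 * b ^ 2 := by positivity
  unfold sqDist
  rw [← lintegral_const_mul' _ _ ENNReal.ofReal_ne_top,
    ← lintegral_const_mul' _ _ ENNReal.ofReal_ne_top,
    ← lintegral_add_left' ((aemeasurable_sqDist u u').ennreal_ofReal.const_mul _)]
  refine lintegral_mono_ae ?_
  filter_upwards [coe_lin a b u v, coe_lin a b u' v', grad_lin a b u v, grad_lin a b u' v']
    with x h1 h2 h3 h4
  rw [← ENNReal.ofReal_mul ha, ← ENNReal.ofReal_mul hb, ← ENNReal.ofReal_add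
    (mul_nonneg ha (sqDist_integrand_nonneg _ _ _)) (mul_nonneg hb (sqDist_integrand_nonneg _ _ _)),
    h1, h2, h3, h4]
  apply ENNReal.ofReal_le_ofReal
  have h5 : a • u.grad x + b • v.grad x - (a • u'.grad x + b • v'.grad x) =
      a • (u.grad x - u'.grad x) + b • (v.grad x - v'.grad x) := by
    simp only [smul_sub]; abel
  rw [h5]
  have h6 := metric_lin_le (g := g) x a b (u.grad x - u'.grad x) (v.grad x - v'.grad x)
  nlinarith [sq_nonneg (a * (u x - u' x) - b * (v x - v' x))]

theorem sqDist_lerp (s t : ℝ) (u v : H1 g) :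
    sqDist (lin (1 - s) s u v) (lin (1 - t) t u v) = ENNReal.ofReal ((s - t) ^ 2) * sqDist u v := by
  unfold sqDist
  rw [← lintegral_const_mul' _ _ ENNReal.ofReal_ne_top]
  refine lintegral_congr_ae ?_
  filter_upwards [coe_lin (1 - s) s u v, coe_lin (1 - t) t u v, grad_lin (1 - s) s u v,
    grad_lin (1 - t) t u v] with x h1 h2 h3 h4
  rw [← ENNReal.ofReal_mul (sq_nonneg _), h1, h2, h3, h4]
  have h5 : (1 - s) • u.grad x + s • v.grad x - ((1 - t) • u.grad x + t • v.grad x) =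
      (t - s) • (u.grad x - v.grad x) := by
    module
  rw [h5]
  simp only [map_smul, smul_apply, smul_eq_mul]
  congr 1; ring

theorem lerp_zero (u v : H1 g) : lin (1 - 0) 0 u v = u := by
  refine ext_ae ?_
  filter_upwards [coe_lin (1 - 0) 0 u v] with x h
  rw [h]; ring

theorem lerp_one (u v : H1 g) : lin (1 - 1) 1 u v = v := by
  refine ext_ae ?_
  filter_upwards [coe_lin (1 - 1) 1 u v] with x h
  rw [h]; ring

/-- Write `sign(u)∇u - sign(v)∇v = sign(u)(∇u - ∇v) + (sign(u) - sign(v))∇v`. The last term involves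
only the gradient of the limit `v`, so dominated convergence applies to it. -/
theorem sqDist_abs_le (u v : H1 g) : sqDist (abs u) (abs v) ≤ ENNReal.ofReal 2 * sqDist u v +
    ∫⁻ x, ENNReal.ofReal (2 * ((SignType.sign (u x) : ℝ) - SignType.sign (v x)) ^ 2 *
      g.inner x (v.grad x) (v.grad x)) ∂(vol g) := by
  unfold sqDist
  rw [← lintegral_const_mul' _ _ ENNReal.ofReal_ne_top,
    ← lintegral_add_left' ((aemeasurable_sqDist u v).ennreal_ofReal.const_mul _)]
  refine lintegral_mono_ae ?_
  filter_upwards [coe_abs u, coe_abs v, grad_abs u, grad_abs v] with x h1 h2 h3 h4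
  have hs : (SignType.sign (u x) : ℝ) ^ 2 ≤ 1 := by
    rcases lt_trichotomy (u x) 0 with h | h | h <;> simp [h]
  have hq := metric_self_nonneg g x (v.grad x)
  have hq' := metric_self_nonneg g x (u.grad x - v.grad x)
  rw [← ENNReal.ofReal_mul zero_le_two,
    ← ENNReal.ofReal_add (mul_nonneg zero_le_two (sqDist_integrand_nonneg _ _ _)) (by positivity),
    h1, h2, h3, h4]
  apply ENNReal.ofReal_le_ofReal
  have h5 : (SignType.sign (u x) : ℝ) • u.grad x - (SignType.sign (v x) : ℝ) • v.grad x =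
      (SignType.sign (u x) : ℝ) • (u.grad x - v.grad x) +
      ((SignType.sign (u x) : ℝ) - SignType.sign (v x)) • v.grad x := by
    module
  rw [h5]
  have h6 := metric_lin_le (g := g) x (SignType.sign (u x) : ℝ)
    ((SignType.sign (u x) : ℝ) - SignType.sign (v x)) (u.grad x - v.grad x) (v.grad x)
  have h7 : (|u x| - |v x|) ^ 2 ≤ (u x - v x) ^ 2 := sq_le_sq.2 (abs_abs_sub_abs_le_abs_sub _ _)
  nlinarith [sq_nonneg (u x - v x)]

theorem exists_subseq_tendsto_ae {u : ℕ → H1 g} {v : H1 g}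
    (h : Tendsto (fun k => sqDist (u k) v) atTop (𝓝 0)) :
    ∃ ms : ℕ → ℕ, StrictMono ms ∧ ∀ᵐ x ∂(vol g), Tendsto (fun k => u (ms k) x) atTop (𝓝 (v x)) := by
  have h1 : Tendsto (fun k => eLpNorm ((fun x => (u k x - v x) ^ 2) - 0) 1 (vol g)) atTop (𝓝 0) := by
    refine tendsto_of_tendsto_of_tendsto_of_le_of_le tendsto_const_nhds h (fun _ => zero_le)
      fun k => ?_
    simp only [sub_zero]
    rw [eLpNorm_one_eq_lintegral_enorm]
    refine lintegral_mono fun x => ?_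
    rw [Real.enorm_eq_ofReal_abs, abs_of_nonneg (sq_nonneg _)]
    exact ENNReal.ofReal_le_ofReal (le_add_of_nonneg_right (metric_self_nonneg g _ _))
  have h2 := tendstoInMeasure_of_tendsto_eLpNorm one_ne_zero
    (fun k => (((u k).memLp.1.sub v.memLp.1).pow 2)) aestronglyMeasurable_zero h1
  obtain ⟨ms, hms, hae⟩ := h2.exists_seq_tendsto_ae
  refine ⟨ms, hms, ?_⟩
  filter_upwards [hae] with x hx
  have h3 : Tendsto (fun k => √((u (ms k) x - v x) ^ 2)) atTop (𝓝 √0) := hx.sqrt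
  simp only [Real.sqrt_sq_eq_abs, Real.sqrt_zero] at h3
  have h4 := (tendsto_zero_iff_abs_tendsto_zero _).2 h3
  simpa using h4.add_const (v x)

/-- The absolute value is continuous on `H¹(N)`. -/
theorem tendsto_sqDist_abs {u : ℕ → H1 g} {v : H1 g}
    (h : Tendsto (fun k => sqDist (u k) v) atTop (𝓝 0)) :
    Tendsto (fun k => sqDist (abs (u k)) (abs v)) atTop (𝓝 0) := by
  -- It suffices to find, in each subsequence, a further one that converges; this gives almost
  -- everywhere convergence of the values.
  refine tendsto_of_subseq_tendsto fun ns hns => ?_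
  have h' : Tendsto (fun k => sqDist (u (ns k)) v) atTop (𝓝 0) := h.comp hns
  obtain ⟨ms, hms, hae⟩ := exists_subseq_tendsto_ae h'
  refine ⟨ms, ?_⟩
  have hq : AEMeasurable (fun x => g.inner x (v.grad x) (v.grad x)) (vol g) :=
    aemeasurable_metric_grad v
  have hint : Tendsto (fun k => ∫⁻ x, ENNReal.ofReal (2 * ((SignType.sign (u (ns (ms k)) x) : ℝ) -
      SignType.sign (v x)) ^ 2 * g.inner x (v.grad x) (v.grad x)) ∂(vol g)) atTop
      (𝓝 (∫⁻ _, 0 ∂(vol g))) := by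
    refine tendsto_lintegral_of_dominated_convergence'
      (fun x => ENNReal.ofReal 8 * ENNReal.ofReal (g.inner x (v.grad x) (v.grad x)))
      (fun k => ?_) (fun k => ae_of_all _ fun x => ?_) ?_ ?_
    · have hsu := measurable_coe_sign.comp_aemeasurable (u (ns (ms k))).memLp.1.aemeasurable
      have hsv := measurable_coe_sign.comp_aemeasurable v.memLp.1.aemeasurable
      exact ((((hsu.sub hsv).pow_const 2).const_mul 2).mul hq).ennreal_ofReal
    · beta_reduce
      rw [← ENNReal.ofReal_mul (by norm_num)]
      refine ENNReal.ofReal_le_ofReal (mul_le_mul_of_nonneg_right ?_ (metric_self_nonneg g _ _))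
      have hb : ∀ t : ℝ, |(SignType.sign t : ℝ)| ≤ 1 := fun t => by
        rcases lt_trichotomy t 0 with h | h | h <;> simp [h]
      have h1 := abs_le.1 (hb (u (ns (ms k)) x))
      have h2 := abs_le.1 (hb (v x))
      nlinarith
    · rw [lintegral_const_mul' _ _ ENNReal.ofReal_ne_top]
      exact (ENNReal.mul_lt_top ENNReal.ofReal_lt_top v.isL2Gradient.finite).ne
    · filter_upwards [hae, grad_eq_zero_of_eq_zero v] with x hx h0
      -- Signs converge where `v ≠ 0`; where `v = 0` they need not, but there `∇v = 0`.
      rcases eq_or_ne (v x) 0 with hv | hv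
      · simp [h0 hv]
      · have h1 : Tendsto (fun k => (SignType.sign (u (ns (ms k)) x) : ℝ)) atTop
            (𝓝 (SignType.sign (v x) : ℝ)) :=
          ((continuous_of_discreteTopology (f := fun s : SignType => (s : ℝ))).tendsto _).comp
            ((continuousAt_sign_of_ne_zero hv).tendsto.comp hx)
        have h2 := ((((h1.sub_const (SignType.sign (v x) : ℝ)).pow 2).const_mul 2).mul_const
          (g.inner x (v.grad x) (v.grad x)))
        have h3 := ENNReal.tendsto_ofReal h2
        simpa using h3
  rw [lintegral_zero] at hint
  have h2 : Tendsto (fun k => ENNReal.ofReal 2 * sqDist (u (ns (ms k))) v) atTop (𝓝 0) := by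
    have := ENNReal.Tendsto.const_mul (h'.comp hms.tendsto_atTop)
      (Or.inr (ENNReal.ofReal_ne_top (r := 2)))
    simpa using this
  refine tendsto_of_tendsto_of_tendsto_of_le_of_le tendsto_const_nhds
    (h := fun k => ENNReal.ofReal 2 * sqDist (u (ns (ms k))) v + _) ?_ (fun _ => zero_le)
    fun k => sqDist_abs_le (u (ns (ms k))) v
  simpa using h2.add hint

end H1

open H1

theorem ContinuousPath.const (u : H1 g) : ContinuousPath fun _ => u :=
  continuousPath_iff.2 fun _ => by simp [sqDist_self]

theorem ContinuousPath.abs {φ : unitInterval → H1 g} (h : ContinuousPath φ) :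
    ContinuousPath fun t => H1.abs (φ t) := by
  rw [continuousPath_iff] at h ⊢
  intro t
  refine tendsto_of_seq_tendsto fun ns hns => ?_
  exact tendsto_sqDist_abs ((h t).comp hns)

theorem ContinuousPath.lin {φ ψ : unitInterval → H1 g} (hφ : ContinuousPath φ)
    (hψ : ContinuousPath ψ) (a b : ℝ) : ContinuousPath fun t => H1.lin a b (φ t) (ψ t) := by
  rw [continuousPath_iff] at hφ hψ ⊢
  intro t
  refine tendsto_of_tendsto_of_tendsto_of_le_of_le tendsto_const_nhds ?_ (fun _ => zero_le)
    fun s => sqDist_lin_le a b _ _ _ _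
  have := (ENNReal.Tendsto.const_mul (hφ t)
    (Or.inr (ENNReal.ofReal_ne_top (r := 2 * a ^ 2)))).add (ENNReal.Tendsto.const_mul (hψ t)
    (Or.inr (ENNReal.ofReal_ne_top (r := 2 * b ^ 2))))
  simpa using this

theorem ContinuousPath.lerp (u v : H1 g) :
    ContinuousPath fun t : unitInterval => H1.lin (1 - (t : ℝ)) t u v := by
  rw [continuousPath_iff]
  intro t
  simp only [sqDist_lerp]
  have h1 : Tendsto (fun s : unitInterval => ENNReal.ofReal (((s : ℝ) - t) ^ 2)) (𝓝 t) (𝓝 0) := by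
    have : Continuous fun s : unitInterval => ENNReal.ofReal (((s : ℝ) - t) ^ 2) :=
      ENNReal.continuous_ofReal.comp (by fun_prop)
    simpa using this.tendsto t
  simpa using ENNReal.Tendsto.mul_const h1 (Or.inr (sqDist_lt_top u v).ne)

namespace H1

/-- The pointwise maximum. -/
def sup (u v : H1 g) : H1 g := lin (1 / 2) (1 / 2) (lin 1 1 u v) (abs (lin 1 (-1) u v))

/-- The pointwise minimum. -/
def inf (u v : H1 g) : H1 g := lin (1 / 2) (-(1 / 2)) (lin 1 1 u v) (abs (lin 1 (-1) u v))

theorem coe_sup (u v : H1 g) : ∀ᵐ x ∂(vol g), sup u v x = max (u x) (v x) := by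
  filter_upwards [coe_lin (1 / 2) (1 / 2) (lin 1 1 u v) (abs (lin 1 (-1) u v)), coe_lin 1 1 u v,
    coe_abs (lin 1 (-1) u v), coe_lin 1 (-1) u v] with x h1 h2 h3 h4
  rw [sup, h1, h2, h3, h4, show 1 * u x + -1 * v x = u x - v x by ring]
  rcases le_total (u x) (v x) with h | h
  · rw [max_eq_right h, abs_of_nonpos (by linarith)]; ring
  · rw [max_eq_left h, abs_of_nonneg (by linarith)]; ring

theorem coe_inf (u v : H1 g) : ∀ᵐ x ∂(vol g), inf u v x = min (u x) (v x) := by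
  filter_upwards [coe_lin (1 / 2) (-(1 / 2)) (lin 1 1 u v) (abs (lin 1 (-1) u v)), coe_lin 1 1 u v,
    coe_abs (lin 1 (-1) u v), coe_lin 1 (-1) u v] with x h1 h2 h3 h4
  rw [inf, h1, h2, h3, h4, show 1 * u x + -1 * v x = u x - v x by ring]
  rcases le_total (u x) (v x) with h | h
  · rw [min_eq_left h, abs_of_nonpos (by linarith)]; ring
  · rw [min_eq_right h, abs_of_nonneg (by linarith)]; ring

theorem grad_half_abs_sub (c : ℝ) (u v : H1 g) : ∀ᵐ x ∂(vol g),
    (lin (1 / 2) c (lin 1 1 u v) (abs (lin 1 (-1) u v))).grad x =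
      (1 / 2 : ℝ) • (u.grad x + v.grad x) +
      (c * (SignType.sign (u x - v x) : ℝ)) • (u.grad x - v.grad x) := by
  filter_upwards [grad_lin (1 / 2) c (lin 1 1 u v) (abs (lin 1 (-1) u v)), grad_lin 1 1 u v,
    grad_abs (lin 1 (-1) u v), coe_lin 1 (-1) u v, grad_lin 1 (-1) u v] with x h1 h2 h3 h4 h5
  rw [h1, h2, h3, h4, h5, show 1 * u x + -1 * v x = u x - v x by ring]
  module

/-- Passing from `v` to `min(u,v)` multiplies `∇u - ∇v` by `(1 + sign(u - v))/2`, which is `0`,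
`1/2` or `1`. -/
theorem sqDist_inf_le (u v : H1 g) : sqDist u (inf u v) ≤ sqDist u v := by
  refine lintegral_mono_ae ?_
  filter_upwards [coe_inf u v, grad_half_abs_sub (-(1 / 2)) u v] with x h1 h2
  apply ENNReal.ofReal_le_ofReal
  rw [h1, inf, h2]
  have h3 : u.grad x - ((1 / 2 : ℝ) • (u.grad x + v.grad x) +
      (-(1 / 2) * (SignType.sign (u x - v x) : ℝ)) • (u.grad x - v.grad x)) =
      ((1 / 2) * (1 + (SignType.sign (u x - v x) : ℝ))) • (u.grad x - v.grad x) := by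
    module
  rw [h3]
  simp only [map_smul, smul_apply, smul_eq_mul]
  have hq := metric_self_nonneg g x (u.grad x - v.grad x)
  have h4 : (u x - min (u x) (v x)) ^ 2 ≤ (u x - v x) ^ 2 := by
    rcases min_cases (u x) (v x) with ⟨h, _⟩ | ⟨h, _⟩ <;> rw [h]
    nlinarith [sq_nonneg (u x - v x)]
  have h5 : ((1 / 2) * (1 + (SignType.sign (u x - v x) : ℝ))) ^ 2 ≤ 1 := by
    rcases lt_trichotomy (u x - v x) 0 with h | h | h
    · simp [sign_neg h]
    · rw [h]; norm_num
    · rw [sign_pos h]; norm_num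
  nlinarith

end H1

theorem ContinuousPath.sup {φ : unitInterval → H1 g} (h : ContinuousPath φ) (w : H1 g) :
    ContinuousPath fun t => H1.sup (φ t) w :=
  (h.lin (.const w) 1 1).lin (h.lin (.const w) 1 (-1)).abs (1 / 2) (1 / 2)

theorem ContinuousPath.inf {φ : unitInterval → H1 g} (h : ContinuousPath φ) (w : H1 g) :
    ContinuousPath fun t => H1.inf (φ t) w :=
  (h.lin (.const w) 1 1).lin (h.lin (.const w) 1 (-1)).abs (1 / 2) (-(1 / 2))

end Distance

/-! ### The Allen–Cahn energy: submodularity and control under perturbation -/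

/-- A nonnegative `C²` potential varies, up to a small relative error, at most quadratically. -/
theorem IsDoubleWell.exists_le_add_sq {W : ℝ → ℝ} (hW : IsDoubleWell W) {δ : ℝ} (hδ : 0 < δ) :
    ∃ C, 0 ≤ C ∧ ∀ a ∈ Icc (-1 : ℝ) 1, ∀ b ∈ Icc (-1 : ℝ) 1,
      W b ≤ (1 + δ) * W a + C * (b - a) ^ 2 := by
  have hW1 : Differentiable ℝ W := hW.contDiff.differentiable (by simp)
  have hW' : ContDiff ℝ ∞ (deriv W) :=
    (contDiff_infty_iff_deriv.1 hW.contDiff).2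
  have hW1' : Differentiable ℝ (deriv W) := hW'.differentiable (by simp)
  have hW'' : Continuous (deriv (deriv W)) :=
    (contDiff_infty_iff_deriv.1 hW').2.continuous
  obtain ⟨M1, hM1⟩ := isCompact_Icc.exists_bound_of_continuousOn (s := Icc (-2 : ℝ) 2)
    hW'.continuous.continuousOn
  obtain ⟨M2, hM2⟩ := isCompact_Icc.exists_bound_of_continuousOn (s := Icc (-2 : ℝ) 2)
    hW''.continuousOn
  set M := max 1 (max M1 M2) with hM
  have hM0 : 1 ≤ M := le_max_left _ _
  have hb1 : ∀ x ∈ Icc (-2 : ℝ) 2, |deriv W x| ≤ M := fun x hx =>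
    (hM1 x hx).trans ((le_max_left _ _).trans (le_max_right _ _))
  have hb2 : ∀ x ∈ Icc (-2 : ℝ) 2, |deriv (deriv W) x| ≤ M := fun x hx =>
    (hM2 x hx).trans ((le_max_right _ _).trans (le_max_right _ _))
  have hlip : ∀ x ∈ Icc (-2 : ℝ) 2, ∀ y ∈ Icc (-2 : ℝ) 2,
      |deriv W y - deriv W x| ≤ M * |y - x| := fun x hx y hy =>
    (convex_Icc (-2 : ℝ) 2).norm_image_sub_le_of_norm_deriv_le (fun z _ => hW1' z) hb2 hx hy
  have htaylor : ∀ x ∈ Icc (-2 : ℝ) 2, ∀ y ∈ Icc (-2 : ℝ) 2,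
      W y ≤ W x + deriv W x * (y - x) + M * (y - x) ^ 2 := by
    intro x hx y hy
    have hsub : uIcc x y ⊆ Icc (-2 : ℝ) 2 := uIcc_subset_Icc hx hy
    have hd : ∀ z, HasDerivAt (fun z => W z - deriv W x * z) (deriv W z - deriv W x * 1) z :=
      fun z => (hW1 z).hasDerivAt.sub ((hasDerivAt_id z).const_mul _)
    have := (convex_uIcc x y).norm_image_sub_le_of_norm_hasDerivWithin_le
      (fun z _ => (hd z).hasDerivWithinAt) (C := M * |y - x|) (fun z hz => by
        rw [mul_one, Real.norm_eq_abs]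
        refine (hlip x hx z (hsub hz)).trans ?_
        have := abs_sub_left_of_mem_uIcc hz
        gcongr) left_mem_uIcc right_mem_uIcc
    rw [Real.norm_eq_abs, Real.norm_eq_abs, mul_assoc, abs_mul_abs_self] at this
    have := (abs_le.1 this).2
    nlinarith
  have hgrad : ∀ a ∈ Icc (-1 : ℝ) 1, deriv W a ^ 2 ≤ 4 * M * W a := by
    intro a ha
    have ha2 : a ∈ Icc (-2 : ℝ) 2 := ⟨by linarith [ha.1], by linarith [ha.2]⟩
    -- This `s` minimizes the Taylor upper bound `W a + W'(a) s + M s²`; nonnegativity of `W` at `a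
    -- + s` bounds `W'(a)²`. Since `|s| ≤ 1`, the point `a + s` stays in `[-2, 2]`, where `M` bounds
    -- the derivatives.
    set s := - deriv W a / (2 * M) with hs
    have hsb : |s| ≤ 1 := by
      rw [hs, abs_div, abs_neg, abs_of_pos (show 0 < 2 * M by positivity),
        div_le_one (by positivity)]
      linarith [hb1 a ha2]
    have := abs_le.1 hsb
    have h1 := htaylor a ha2 (a + s) ⟨by linarith [ha.1], by linarith [ha.2]⟩
    have h2 := hW.nonneg (a + s)
    have h3 : deriv W a = - (2 * M * s) := by rw [hs]; field_simp
    rw [h3] at h1 ⊢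
    nlinarith
  refine ⟨M + M / δ, by positivity, fun a ha b hb => ?_⟩
  have h1 := htaylor a ⟨by linarith [ha.1], by linarith [ha.2]⟩ b
    ⟨by linarith [hb.1], by linarith [hb.2]⟩
  have h2 := hgrad a ha
  -- Young's inequality, with the weight chosen so that the term `δ W'(a)² / (4M)` is absorbed by `δ
  -- W(a)`.
  have h3 : deriv W a * (b - a) ≤ δ * W a + M / δ * (b - a) ^ 2 := by
    have h4 : 0 ≤ (δ * deriv W a - 2 * M * (b - a)) ^ 2 := sq_nonneg _
    have h5 : M / δ * (b - a) ^ 2 = (4 * M * M * (b - a) ^ 2) / (4 * M * δ) := by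
      field_simp
    have h6 : deriv W a * (b - a) - δ * W a ≤ (4 * M * M * (b - a) ^ 2) / (4 * M * δ) := by
      rw [le_div_iff₀ (by positivity)]
      have h7 : δ ^ 2 * (deriv W a) ^ 2 ≤ δ ^ 2 * (4 * M * W a) := by gcongr
      nlinarith
    linarith
  nlinarith

section Energy

set_option linter.unusedSectionVars false

variable {n : ℕ} {N : Type*} [TopologicalSpace N] [ChartedSpace (Model n) N]
  [IsManifold (𝓡 (n + 1)) ∞ N] {g : SmoothMetric n N}
  [MeasurableSpace N] [BorelSpace N] [CompactSpace N] {W : ℝ → ℝ} {ε : ℝ}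

open H1

theorem IsDoubleWell.energyDensity_nonneg (hW : IsDoubleWell W) (hε : 0 < ε) (u : H1 g) (x : N) :
    0 ≤ ε * g.inner x (u.grad x) (u.grad x) / 2 + W (u x) / ε := by
  have := metric_self_nonneg g x (u.grad x)
  have := hW.nonneg (u x)
  positivity

theorem IsDoubleWell.aemeasurable_energyDensity (hW : IsDoubleWell W) (u : H1 g) :
    AEMeasurable (fun x => ENNReal.ofReal (ε * g.inner x (u.grad x) (u.grad x) / 2 + W (u x) / ε))
      (vol g) :=
  ((((aemeasurable_metric_grad u).const_mul ε).div_const 2).add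
    ((hW.contDiff.continuous.measurable.comp_aemeasurable
      u.memLp.1.aemeasurable).div_const ε)).ennreal_ofReal

/-- The potential terms have equal sums since max and min permute the two values. The gradients of
max and min are `(∇u + ∇v)/2 ± sign(u - v)(∇u - ∇v)/2`, so the parallelogram law and `sign² ≤ 1`
conclude, with no separate discussion of `{u = v}`. -/
theorem IsDoubleWell.energy_sup_add_energy_inf_le (hW : IsDoubleWell W) (hε : 0 < ε) (u v : H1 g) :
    energy W ε (sup u v) + energy W ε (inf u v) ≤ energy W ε u + energy W ε v := by
  unfold energy
  rw [← lintegral_add_left' (hW.aemeasurable_energyDensity u)]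
  refine (le_lintegral_add _ _).trans (lintegral_mono_ae ?_)
  filter_upwards [coe_sup u v, coe_inf u v, grad_half_abs_sub (1 / 2) u v,
    grad_half_abs_sub (-(1 / 2)) u v] with x h1 h2 h3 h4
  rw [← ENNReal.ofReal_add (hW.energyDensity_nonneg hε _ _) (hW.energyDensity_nonneg hε _ _),
    ← ENNReal.ofReal_add (hW.energyDensity_nonneg hε _ _) (hW.energyDensity_nonneg hε _ _)]
  apply ENNReal.ofReal_le_ofReal
  have hWs : W (sup u v x) + W (inf u v x) = W (u x) + W (v x) := by
    rw [h1, h2]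
    rcases le_total (u x) (v x) with h | h
    · rw [max_eq_right h, min_eq_left h, add_comm]
    · rw [max_eq_left h, min_eq_right h]
  have hq : g.inner x ((sup u v).grad x) ((sup u v).grad x) +
      g.inner x ((inf u v).grad x) ((inf u v).grad x) ≤
      g.inner x (u.grad x) (u.grad x) + g.inner x (v.grad x) (v.grad x) := by
    rw [sup, inf, h3, h4, metric_lin, metric_lin]
    have hs : (SignType.sign (u x - v x) : ℝ) ^ 2 ≤ 1 := by
      rcases lt_trichotomy (u x - v x) 0 with h | h | h
      · rw [sign_neg h]; norm_num
      · rw [h]; norm_num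
      · rw [sign_pos h]; norm_num
    have hd := mul_le_mul_of_nonneg_right hs (metric_self_nonneg g x (u.grad x - v.grad x))
    have hsum : g.inner x (u.grad x + v.grad x) (u.grad x + v.grad x) +
        g.inner x (u.grad x - v.grad x) (u.grad x - v.grad x) =
        2 * (g.inner x (u.grad x) (u.grad x) + g.inner x (v.grad x) (v.grad x)) := by
      simp only [map_add, map_sub, add_apply, sub_apply]; ring
    nlinarith
  have e1 : ∀ p q : ℝ, ε * p / 2 + q / ε = ε / 2 * p + 1 / ε * q := fun p q => by ring
  simp only [e1]
  have hε2 : 0 ≤ ε / 2 := by positivity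
  have := mul_le_mul_of_nonneg_left hq hε2
  have h5 := congrArg (fun r => 1 / ε * r) hWs
  simp only [mul_add] at this h5
  linarith

/-- Young's inequality for the gradients and `exists_le_add_sq` for the potential, integrated. The
relative form of the error keeps `C` independent of `u` and `v`, so step sizes along a path can be
uniform. -/
theorem IsDoubleWell.exists_energy_le (hW : IsDoubleWell W) (hε : 0 < ε) {δ : ℝ} (hδ : 0 < δ) :
    ∃ C, 0 ≤ C ∧ ∀ u v : H1 g, (∀ᵐ x ∂(vol g), |u x| ≤ 1) → (∀ᵐ x ∂(vol g), |v x| ≤ 1) →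
      energy W ε v ≤ ENNReal.ofReal (1 + δ) * energy W ε u + ENNReal.ofReal C * sqDist v u := by
  obtain ⟨C, hC0, hC⟩ := hW.exists_le_add_sq hδ
  refine ⟨C / ε + ε / 2 * (1 + 1 / δ), by positivity, fun u v hu hv => ?_⟩
  unfold energy sqDist
  rw [← lintegral_const_mul' _ _ ENNReal.ofReal_ne_top,
    ← lintegral_const_mul' _ _ ENNReal.ofReal_ne_top,
    ← lintegral_add_left' ((hW.aemeasurable_energyDensity u).const_mul _)]
  refine lintegral_mono_ae ?_
  filter_upwards [hu, hv] with x hux hvx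
  rw [← ENNReal.ofReal_mul (by positivity), ← ENNReal.ofReal_mul (by positivity),
    ← ENNReal.ofReal_add (mul_nonneg (by positivity) (hW.energyDensity_nonneg hε _ _))
      (mul_nonneg (by positivity) (sqDist_integrand_nonneg _ _ _))]
  apply ENNReal.ofReal_le_ofReal
  have h1 := hC (u x) (abs_le.1 hux) (v x) (abs_le.1 hvx)
  have hz := metric_self_nonneg g x (v.grad x - u.grad x)
  have h2 : g.inner x (v.grad x) (v.grad x) ≤ (1 + δ) * g.inner x (u.grad x) (u.grad x) +
      (1 + 1 / δ) * g.inner x (v.grad x - u.grad x) (v.grad x - u.grad x) := by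
    have e1 : v.grad x = (1 : ℝ) • u.grad x + (1 : ℝ) • (v.grad x - u.grad x) := by module
    have h3 := metric_lin (g := g) x 1 1 (u.grad x) (v.grad x - u.grad x)
    rw [← e1] at h3
    have h4 := metric_self_nonneg g x (δ • u.grad x + (-1 : ℝ) • (v.grad x - u.grad x))
    rw [metric_lin] at h4
    rw [h3]
    have h5 : 2 * g.inner x (u.grad x) (v.grad x - u.grad x) ≤
        δ * g.inner x (u.grad x) (u.grad x) +
        1 / δ * g.inner x (v.grad x - u.grad x) (v.grad x - u.grad x) := by
      have : δ * g.inner x (u.grad x) (u.grad x) +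
        1 / δ * g.inner x (v.grad x - u.grad x) (v.grad x - u.grad x) =
        (δ ^ 2 * g.inner x (u.grad x) (u.grad x) +
          g.inner x (v.grad x - u.grad x) (v.grad x - u.grad x)) / δ := by field_simp
      rw [this, le_div_iff₀ hδ]
      linarith
    linarith
  set A := g.inner x (u.grad x) (u.grad x)
  set B := g.inner x (v.grad x) (v.grad x)
  set Z := g.inner x (v.grad x - u.grad x) (v.grad x - u.grad x)
  have h6 : ε * B / 2 ≤ ε * ((1 + δ) * A + (1 + 1 / δ) * Z) / 2 := by gcongr
  have h7 : W (v x) / ε ≤ ((1 + δ) * W (u x) + C * (v x - u x) ^ 2) / ε := by gcongr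
  have h8 : 0 ≤ C / ε * Z := by positivity
  have h9 : 0 ≤ ε / 2 * (1 + 1 / δ) * (v x - u x) ^ 2 := by positivity
  calc _ ≤ _ := add_le_add h6 h7
    _ = (1 + δ) * (ε * A / 2 + W (u x) / ε) + (ε / 2 * (1 + 1 / δ) * Z +
        C / ε * (v x - u x) ^ 2) := by ring
    _ ≤ (1 + δ) * (ε * A / 2 + W (u x) / ε) + (C / ε + ε / 2 * (1 + 1 / δ)) *
        ((v x - u x) ^ 2 + Z) := by nlinarith

end Energy

/-! ### Nested paths: gluing and propagation along a continuous path -/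

section Nested

set_option linter.unusedSectionVars false

variable {n : ℕ} {N : Type*} [TopologicalSpace N] [ChartedSpace (Model n) N]
  [IsManifold (𝓡 (n + 1)) ∞ N] {g : SmoothMetric n N}
  [MeasurableSpace N] [BorelSpace N] [CompactSpace N] {W : ℝ → ℝ} {ε : ℝ}

open H1

/-- An almost minimizer replaces the minimizer of the direct method, so neither compactness nor
lower semicontinuity is needed. -/
theorem exists_le_iInf_add {α : Type*} {s : Set α} (hs : s.Nonempty) (f : α → ℝ≥0∞) {δ : ℝ≥0∞}
    (hδ : δ ≠ 0) : ∃ a ∈ s, ∀ b ∈ s, f a ≤ f b + δ := by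
  by_cases htop : (⨅ a ∈ s, f a) = ⊤
  · obtain ⟨a, ha⟩ := hs
    refine ⟨a, ha, fun b hb => ?_⟩
    have : f b = ⊤ := top_le_iff.1 (htop ▸ iInf₂_le b hb)
    simp [this]
  · obtain ⟨a, ha, hlt⟩ := by
      simpa only [iInf_lt_iff, exists_prop] using ENNReal.lt_add_right htop hδ
    exact ⟨a, ha, fun b hb => hlt.le.trans (by gcongr; exact iInf₂_le b hb)⟩

/-- Nested paths can be concatenated. -/
theorem IsNested.trans {P Q : unitInterval → H1 g} (hP : IsNested P) (hQ : IsNested Q)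
    (hPQ : P 1 = Q 0) : ∃ ψ : unitInterval → H1 g, IsNested ψ ∧ ψ 0 = P 0 ∧ ψ 1 = Q 1 ∧
      ∀ t, (∃ s, ψ t = P s) ∨ ∃ s, ψ t = Q s := by
  classical
  -- Clamping makes both reparametrizations continuous and monotone on all of `[0,1]`; each becomes
  -- constant on the half where it is not used.
  let σ : unitInterval → unitInterval := fun t => projIcc 0 1 zero_le_one (2 * (t : ℝ))
  let τ : unitInterval → unitInterval := fun t => projIcc 0 1 zero_le_one (2 * (t : ℝ) - 1)
  have hσ : Continuous σ := continuous_projIcc.comp (by fun_prop)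
  have hτ : Continuous τ := continuous_projIcc.comp (by fun_prop)
  have hσm : Monotone σ := fun s t hst => monotone_projIcc _ (by
    have : (s : ℝ) ≤ t := hst
    linarith)
  have hτm : Monotone τ := fun s t hst => monotone_projIcc _ (by
    have : (s : ℝ) ≤ t := hst
    linarith)
  let ψ : unitInterval → H1 g := fun t => if (t : ℝ) ≤ 1 / 2 then P (σ t) else Q (τ t)
  have hψ1 : ∀ t : unitInterval, (t : ℝ) ≤ 1 / 2 → ψ t = P (σ t) := fun t ht => if_pos ht
  have hψ2 : ∀ t : unitInterval, 1 / 2 ≤ (t : ℝ) → ψ t = Q (τ t) := fun t ht => by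
    rcases ht.lt_or_eq with h | h
    · exact if_neg h.not_ge
    · rw [hψ1 t h.symm.le]
      have h1 : σ t = 1 := projIcc_of_right_le _ (by linarith)
      have h2 : τ t = 0 := projIcc_of_le_left _ (by linarith)
      rw [h1, h2, hPQ]
  refine ⟨ψ, ⟨?_, ?_⟩, ?_, ?_, fun t => ?_⟩
  · rw [continuousPath_iff]
    intro t
    have hPc := continuousPath_iff.1 hP.continuousPath
    have hQc := continuousPath_iff.1 hQ.continuousPath
    have hA : Tendsto (fun s => sqDist (ψ s) (ψ t)) (𝓝[{s : unitInterval | (s : ℝ) ≤ 1 / 2}] t)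
        (𝓝 0) := by
      by_cases ht : (t : ℝ) ≤ 1 / 2
      · refine Tendsto.congr' ?_ (((hPc (σ t)).comp (hσ.tendsto t)).mono_left nhdsWithin_le_nhds)
        filter_upwards [self_mem_nhdsWithin] with s hs
        rw [hψ1 t ht, hψ1 s hs]; rfl
      · have hcl : IsClosed {s : unitInterval | (s : ℝ) ≤ 1 / 2} :=
          isClosed_le (by fun_prop) (by fun_prop)
        have : 𝓝[{s : unitInterval | (s : ℝ) ≤ 1 / 2}] t = ⊥ := by
          rw [← notMem_closure_iff_nhdsWithin_eq_bot, hcl.closure_eq]; exact ht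
        rw [this]; exact tendsto_bot
    have hB : Tendsto (fun s => sqDist (ψ s) (ψ t)) (𝓝[{s : unitInterval | 1 / 2 ≤ (s : ℝ)}] t)
        (𝓝 0) := by
      by_cases ht : 1 / 2 ≤ (t : ℝ)
      · refine Tendsto.congr' ?_ (((hQc (τ t)).comp (hτ.tendsto t)).mono_left nhdsWithin_le_nhds)
        filter_upwards [self_mem_nhdsWithin] with s hs
        rw [hψ2 t ht, hψ2 s hs]; rfl
      · have hcl : IsClosed {s : unitInterval | 1 / 2 ≤ (s : ℝ)} :=
          isClosed_le (by fun_prop) (by fun_prop)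
        have : 𝓝[{s : unitInterval | 1 / 2 ≤ (s : ℝ)}] t = ⊥ := by
          rw [← notMem_closure_iff_nhdsWithin_eq_bot, hcl.closure_eq]; exact ht
        rw [this]; exact tendsto_bot
    have hu : {s : unitInterval | (s : ℝ) ≤ 1 / 2} ∪ {s : unitInterval | 1 / 2 ≤ (s : ℝ)} = univ :=
      eq_univ_of_forall fun s => by
        simp only [mem_union, mem_ofPred_eq]
        exact le_total _ _
    rw [← nhdsWithin_univ, ← hu, nhdsWithin_union]
    exact hA.sup hB
  · intro t s hts
    have hts' : (t : ℝ) ≤ s := hts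
    rcases le_total (s : ℝ) (1 / 2) with hs | hs
    · rw [hψ1 t (hts'.trans hs), hψ1 s hs]
      exact hP.antitone _ _ (hσm hts)
    · rcases le_total (t : ℝ) (1 / 2) with ht | ht
      · rw [hψ1 t ht, hψ2 s hs]
        have h1 := hP.antitone (σ t) 1 (σ t).2.2
        have h2 := hQ.antitone 0 (τ s) (τ s).2.1
        rw [← hPQ] at h2
        filter_upwards [h1, h2] with x h1 h2 using h2.trans h1
      · rw [hψ2 t ht, hψ2 s hs]
        exact hQ.antitone _ _ (hτm hts)
  · rw [hψ1 0 (by norm_num)]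
    congr 1
    exact projIcc_of_le_left _ (by norm_num)
  · rw [hψ2 1 (by norm_num)]
    congr 1
    exact projIcc_of_right_le _ (by norm_num)
  · by_cases ht : (t : ℝ) ≤ 1 / 2
    · exact Or.inl ⟨_, hψ1 t ht⟩
    · exact Or.inr ⟨_, hψ2 t (not_le.1 ht).le⟩

/-- There is a nested path of functions with values in `[-1, 1]`, of energy at most `L`, which
starts above `u` and ends below `v`. -/
def NestedReach (W : ℝ → ℝ) (ε : ℝ) (L : ℝ≥0∞) (u v : H1 g) : Prop :=
  ∃ ψ : unitInterval → H1 g, IsNested ψ ∧ (∀ᵐ x ∂(vol g), u x ≤ ψ 0 x) ∧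
    (∀ᵐ x ∂(vol g), ψ 1 x ≤ v x) ∧ (∀ t, ∀ᵐ x ∂(vol g), |ψ t x| ≤ 1) ∧ ∀ t, energy W ε (ψ t) ≤ L

/-- The end of the first path lies below the start of the second, so the two must be bridged
downwards through an intermediate `z`. Truncating the paths by `z` makes them meet exactly at `z`,
and the near minimality of `z` keeps the truncation from costing more than `δ`. -/
theorem NestedReach.trans (hW : IsDoubleWell W) (hε : 0 < ε) {u v w : H1 g} {L δ : ℝ≥0∞}
    (hδ : δ ≠ 0) (huv : NestedReach W ε L u v) (hvw : NestedReach W ε L v w) :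
    NestedReach W ε (L + δ) u w := by
  obtain ⟨A, hA, hA0, hA1, hAb, hAE⟩ := huv
  obtain ⟨B, hB, hB0, hB1, hBb, hBE⟩ := hvw
  set S : Set (H1 g) := {z | (∀ᵐ x ∂(vol g), A 1 x ≤ z x) ∧ (∀ᵐ x ∂(vol g), z x ≤ B 0 x)} with hS
  have hAS : A 1 ∈ S := by
    refine ⟨ae_of_all _ fun x => le_rfl, ?_⟩
    filter_upwards [hA1, hB0] with x h1 h2 using h1.trans h2
  obtain ⟨z, ⟨hz1, hz2⟩, hzmin⟩ := exists_le_iInf_add ⟨_, hAS⟩ (energy W ε) hδ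
  have hzb : ∀ᵐ x ∂(vol g), |z x| ≤ 1 := by
    filter_upwards [hz1, hz2, hAb 1, hBb 0] with x h1 h2 h3 h4
    exact abs_le.2 ⟨(abs_le.1 h3).1.trans h1, h2.trans (abs_le.1 h4).2⟩
  -- Submodularity gives `E(p) + E(q) ≤ E(r) + E(z)`, and `E(z) ≤ E(q) + δ` as `q` competes with
  -- `z`. Cancelling `E(q)` requires it to be finite, hence the detour through infinite values.
  have hcancel : ∀ p q r : H1 g, energy W ε p + energy W ε q ≤ energy W ε r + energy W ε z →
      energy W ε r ≤ L → q ∈ S → energy W ε p ≤ L + δ := by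
    intro p q r h1 hr hq
    by_cases htop : L + δ = ⊤
    · rw [htop]; exact le_top
    have hz : energy W ε z ≠ ⊤ :=
      ne_top_of_le_ne_top htop ((hzmin _ hAS).trans (by gcongr; exact hAE 1))
    have hLtop : L ≠ ⊤ := fun h => htop (by simp [h])
    have hqt : energy W ε q ≠ ⊤ := by
      refine ne_top_of_le_ne_top ?_ (le_add_self.trans h1)
      exact ENNReal.add_ne_top.2 ⟨ne_top_of_le_ne_top hLtop hr, hz⟩
    refine (ENNReal.add_le_add_iff_right hqt).1 (h1.trans ?_)
    calc energy W ε r + energy W ε z ≤ L + (energy W ε q + δ) := add_le_add hr (hzmin q hq)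
      _ = L + δ + energy W ε q := by ring
  have hbound : ∀ {a b c : ℝ}, |a| ≤ 1 → |b| ≤ 1 → (c = a ∨ c = b) → |c| ≤ 1 := by
    rintro a b c ha hb (rfl | rfl) <;> assumption
  have hP : IsNested fun t => H1.sup (A t) z := by
    refine ⟨hA.continuousPath.sup z, fun t s hts => ?_⟩
    filter_upwards [hA.antitone t s hts, coe_sup (A t) z, coe_sup (A s) z] with x h1 h2 h3
    rw [h2, h3]
    exact max_le_max_right _ h1
  have hQ : IsNested fun t => H1.inf (B t) z := by
    refine ⟨hB.continuousPath.inf z, fun t s hts => ?_⟩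
    filter_upwards [hB.antitone t s hts, coe_inf (B t) z, coe_inf (B s) z] with x h1 h2 h3
    rw [h2, h3]
    exact min_le_min_right _ h1
  have hPQ : H1.sup (A 1) z = H1.inf (B 0) z := by
    refine ext_ae ?_
    filter_upwards [coe_sup (A 1) z, coe_inf (B 0) z, hz1, hz2] with x h1 h2 h3 h4
    rw [h1, h2, max_eq_right h3, min_eq_right h4]
  obtain ⟨ψ, hψ, hψ0, hψ1, hψ2⟩ := hP.trans hQ hPQ
  refine ⟨ψ, hψ, ?_, ?_, fun t => ?_, fun t => ?_⟩
  · rw [hψ0]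
    filter_upwards [coe_sup (A 0) z, hA0] with x h1 h2
    rw [h1]
    exact h2.trans (le_max_left _ _)
  · rw [hψ1]
    filter_upwards [coe_inf (B 1) z, hB1] with x h1 h2
    rw [h1]
    exact (min_le_left _ _).trans h2
  · rcases hψ2 t with ⟨s, hs⟩ | ⟨s, hs⟩ <;> rw [hs]
    · filter_upwards [coe_sup (A s) z, hAb s, hzb] with x h1 h2 h3
      rw [h1]; exact hbound h2 h3 (max_choice _ _)
    · filter_upwards [coe_inf (B s) z, hBb s, hzb] with x h1 h2 h3
      rw [h1]; exact hbound h2 h3 (min_choice _ _)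
  · rcases hψ2 t with ⟨s, hs⟩ | ⟨s, hs⟩ <;> rw [hs]
    · refine hcancel _ (inf (A s) z) (A s) (hW.energy_sup_add_energy_inf_le hε _ _) (hAE s) ⟨?_, ?_⟩
      · filter_upwards [coe_inf (A s) z, hA.antitone s 1 s.2.2, hz1] with x h1 h2 h3
        rw [h1]; exact le_min h2 h3
      · filter_upwards [coe_inf (A s) z, hz2] with x h1 h2
        rw [h1]; exact (min_le_right _ _).trans h2
    · refine hcancel _ (sup (B s) z) (B s) ?_ (hBE s) ⟨?_, ?_⟩
      · rw [add_comm]; exact hW.energy_sup_add_energy_inf_le hε _ _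
      · filter_upwards [coe_sup (B s) z, hz1] with x h1 h2
        rw [h1]; exact h2.trans (le_max_right _ _)
      · filter_upwards [coe_sup (B s) z, hB.antitone 0 s s.2.1, hz2] with x h1 h2 h3
        rw [h1]; exact max_le h2 h3

theorem abs_lerp_inf_le {u v : H1 g} (hu : ∀ᵐ x ∂(vol g), |u x| ≤ 1)
    (hv : ∀ᵐ x ∂(vol g), |v x| ≤ 1) (s : unitInterval) :
    ∀ᵐ x ∂(vol g), |lin (1 - (s : ℝ)) s u (inf u v) x| ≤ 1 := by
  filter_upwards [hu, hv, coe_inf u v, coe_lin (1 - (s : ℝ)) s u (inf u v)] with x h1 h2 h3 h4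
  have hi : |inf u v x| ≤ 1 := by
    rw [h3]; rcases min_choice (u x) (v x) with h | h <;> rw [h] <;> assumption
  rw [h4]
  have hs0 : (0 : ℝ) ≤ s := s.2.1
  have hs1 : (0 : ℝ) ≤ 1 - s := sub_nonneg.2 s.2.2
  refine (abs_add_le _ _).trans ?_
  rw [abs_mul, abs_mul, abs_of_nonneg hs0, abs_of_nonneg hs1]
  nlinarith

/-- The straight path from `u` to `min u v`. -/
theorem nestedReach_of_lerp {u v : H1 g} {L : ℝ≥0∞} (hu : ∀ᵐ x ∂(vol g), |u x| ≤ 1)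
    (hv : ∀ᵐ x ∂(vol g), |v x| ≤ 1)
    (h : ∀ s : unitInterval, energy W ε (lin (1 - (s : ℝ)) s u (inf u v)) ≤ L) :
    NestedReach W ε L u v := by
  refine ⟨fun s => lin (1 - (s : ℝ)) s u (inf u v), ⟨ContinuousPath.lerp _ _, fun t s hts => ?_⟩,
    ?_, ?_, abs_lerp_inf_le hu hv, h⟩
  · filter_upwards [coe_inf u v, coe_lin (1 - (s : ℝ)) s u (inf u v),
      coe_lin (1 - (t : ℝ)) t u (inf u v)] with x h1 h2 h3
    rw [h2, h3]
    have h4 : inf u v x ≤ u x := by rw [h1]; exact min_le_left _ _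
    have h5 : (t : ℝ) ≤ s := hts
    nlinarith
  · have h0 : lin (1 - ((0 : unitInterval) : ℝ)) ((0 : unitInterval) : ℝ) u (inf u v) = u :=
      lerp_zero u _
    beta_reduce
    rw [h0]
    exact ae_of_all _ fun x => le_rfl
  · have h0 : lin (1 - ((1 : unitInterval) : ℝ)) ((1 : unitInterval) : ℝ) u (inf u v) = inf u v :=
      lerp_one u _
    beta_reduce
    rw [h0]
    filter_upwards [coe_inf u v] with x h1
    rw [h1]; exact min_le_right _ _

theorem sqDist_lerp_inf_le (u v : H1 g) (s : unitInterval) :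
    sqDist (lin (1 - (s : ℝ)) s u (inf u v)) u ≤ sqDist u v := by
  have h := sqDist_lerp (s : ℝ) 0 u (inf u v)
  rw [lerp_zero] at h
  rw [h]
  refine (mul_le_of_le_one_left zero_le ?_).trans (sqDist_inf_le u v)
  rw [sub_zero, ENNReal.ofReal_le_one]
  have h1 : (s : ℝ) ≤ 1 := s.2.2
  have h0 : (0 : ℝ) ≤ s := s.2.1
  nlinarith

/-- Close functions of energy at most `Λ` are joined by a nested path of almost the same energy. -/
theorem exists_nestedReach_of_sqDist_le (hW : IsDoubleWell W) (hε : 0 < ε) {Λ : ℝ≥0∞} (hΛ : Λ ≠ ⊤)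
    {κ : ℝ} (hκ : 0 < κ) : ∃ η : ℝ≥0∞, 0 < η ∧ ∀ u v : H1 g, (∀ᵐ x ∂(vol g), |u x| ≤ 1) →
      (∀ᵐ x ∂(vol g), |v x| ≤ 1) → energy W ε u ≤ Λ → sqDist u v ≤ η →
        NestedReach W ε (Λ + ENNReal.ofReal κ) u v := by
  have hl : 0 ≤ Λ.toReal := ENNReal.toReal_nonneg
  -- Half of `κ` pays for the relative error `δ Λ`, the other half for the quadratic error `C η`;
  -- the `+ 1` in each denominator avoids division by zero.
  set δ : ℝ := κ / (2 * (Λ.toReal + 1)) with hδ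
  obtain ⟨C, hC0, hC⟩ := hW.exists_energy_le (g := g) hε (δ := δ) (by positivity)
  refine ⟨ENNReal.ofReal (κ / (2 * (C + 1))), ENNReal.ofReal_pos.2 (by positivity),
    fun u v hu hv hE hd => nestedReach_of_lerp hu hv fun s => ?_⟩
  refine (hC u _ hu (abs_lerp_inf_le hu hv s)).trans ?_
  have h1 : ENNReal.ofReal (1 + δ) * energy W ε u ≤ Λ + ENNReal.ofReal (κ / 2) := by
    calc ENNReal.ofReal (1 + δ) * energy W ε u ≤ ENNReal.ofReal (1 + δ) * Λ := by gcongr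
      _ = ENNReal.ofReal ((1 + δ) * Λ.toReal) := by
        rw [ENNReal.ofReal_mul (by positivity), ENNReal.ofReal_toReal hΛ]
      _ ≤ ENNReal.ofReal (Λ.toReal + κ / 2) := by
        apply ENNReal.ofReal_le_ofReal
        have : δ * Λ.toReal ≤ κ / 2 := by
          rw [hδ, div_mul_eq_mul_div, div_le_div_iff₀ (by positivity) (by positivity)]
          nlinarith
        linarith
      _ = _ := by rw [ENNReal.ofReal_add hl (by positivity), ENNReal.ofReal_toReal hΛ]
  have h2 : ENNReal.ofReal C * sqDist (lin (1 - (s : ℝ)) s u (inf u v)) u ≤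
      ENNReal.ofReal (κ / 2) := by
    calc _ ≤ ENNReal.ofReal C * ENNReal.ofReal (κ / (2 * (C + 1))) := by
          gcongr
          exact (sqDist_lerp_inf_le u v s).trans hd
      _ = ENNReal.ofReal (C * (κ / (2 * (C + 1)))) := (ENNReal.ofReal_mul hC0).symm
      _ ≤ _ := by
        apply ENNReal.ofReal_le_ofReal
        rw [mul_div_assoc', div_le_div_iff₀ (by positivity) (by positivity)]
        nlinarith
  calc _ ≤ Λ + ENNReal.ofReal (κ / 2) + ENNReal.ofReal (κ / 2) := add_le_add h1 h2
    _ = Λ + ENNReal.ofReal κ := by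
      rw [add_assoc, ← ENNReal.ofReal_add (by positivity) (by positivity), add_halves]

theorem NestedReach.mono {u v : H1 g} {L L' : ℝ≥0∞} (h : NestedReach W ε L u v) (hL : L ≤ L') :
    NestedReach W ε L' u v := by
  obtain ⟨ψ, h1, h2, h3, h4, h5⟩ := h
  exact ⟨ψ, h1, h2, h3, h4, fun t => (h5 t).trans hL⟩

/-- The set of times reachable from `φ 0` is nonempty and clopen in the connected interval, since
one distance `η` works along the whole path. -/
theorem nestedReach_of_continuousPath (hW : IsDoubleWell W) (hε : 0 < ε)
    {φ : unitInterval → H1 g} (hφ : ContinuousPath φ) (hφ1 : ∀ t, ∀ᵐ x ∂(vol g), |φ t x| ≤ 1)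
    {Λ : ℝ≥0∞} (hΛ : Λ ≠ ⊤) (hE : ∀ t, energy W ε (φ t) ≤ Λ) {κ : ℝ} (hκ : 0 < κ) :
    NestedReach W ε (Λ + ENNReal.ofReal κ) (φ 0) (φ 1) := by
  obtain ⟨η, hη, hstep⟩ := exists_nestedReach_of_sqDist_le (g := g) hW hε hΛ (half_pos hκ)
  -- Quantifying over every `L` above the threshold absorbs the loss at each gluing: reach with a
  -- smaller `L'` and spend `L - L'`. The remaining `κ / 2` makes the final inequality strict.
  set S : Set unitInterval :=
    {t | ∀ L, Λ + ENNReal.ofReal (κ / 2) < L → NestedReach W ε L (φ 0) (φ t)} with hS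
  have hprop : ∀ s t, sqDist (φ s) (φ t) ≤ η → s ∈ S → t ∈ S := by
    intro s t hst hs L hL
    obtain ⟨L', hL', hLL'⟩ := exists_between hL
    have h1 := (hs L' hL').trans hW hε (δ := L - L') (tsub_pos_of_lt hLL').ne'
      ((hstep _ _ (hφ1 s) (hφ1 t) (hE s) hst).mono hL'.le)
    rwa [add_tsub_cancel_of_le hLL'.le] at h1
  have hnear : ∀ t, ∀ᶠ s in 𝓝 t, sqDist (φ s) (φ t) ≤ η := fun t =>
    (continuousPath_iff.1 hφ t).eventually (ge_mem_nhds hη)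
  have hopen : IsOpen S := isOpen_iff_mem_nhds.2 fun t ht => by
    filter_upwards [hnear t] with s hs
    exact hprop t s (by rwa [sqDist_comm]) ht
  have hclosed : IsClosed S := ⟨isOpen_iff_mem_nhds.2 fun t ht => by
    filter_upwards [hnear t] with s hs hsS
    exact ht (hprop s t hs hsS)⟩
  have h0 : (0 : unitInterval) ∈ S := fun L hL =>
    (hstep _ _ (hφ1 0) (hφ1 0) (hE 0) (by simp [sqDist_self])).mono hL.le
  have huniv : S = univ := IsClopen.eq_univ ⟨hclosed, hopen⟩ ⟨0, h0⟩
  have h1 : (1 : unitInterval) ∈ S := by rw [huniv]; trivial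
  refine h1 _ (ENNReal.add_lt_add_left hΛ ?_)
  exact (ENNReal.ofReal_lt_ofReal_iff hκ).2 (by linarith)

end Nested

end AllenCahn

end

theorem proposition3p5 (n : ℕ) (N : Type*) [TopologicalSpace N] [T2Space N] [CompactSpace N]
    [ChartedSpace (AllenCahn.Model n) N] [IsManifold (𝓡 (n + 1)) ∞ N]
    [MeasurableSpace N] [BorelSpace N] (g : AllenCahn.SmoothMetric n N)
    (W : ℝ → ℝ) (hW : AllenCahn.IsDoubleWell W) (ε : ℝ) (hε : 0 < ε)
    (φ : unitInterval → AllenCahn.H1 g) (hφ : AllenCahn.ContinuousPath φ)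
    (hφ1 : ∀ t, ∀ᵐ x ∂(AllenCahn.vol g), |φ t x| ≤ 1) (κ : ℝ) (hκ : 0 < κ) :
    ∃ ψ : unitInterval → AllenCahn.H1 g,
      AllenCahn.IsNested ψ ∧
      (∀ᵐ x ∂(AllenCahn.vol g), φ 0 x ≤ ψ 0 x) ∧
      (∀ᵐ x ∂(AllenCahn.vol g), ψ 1 x ≤ φ 1 x) ∧
      (∀ t, ∀ᵐ x ∂(AllenCahn.vol g), |ψ t x| ≤ 1) ∧
      (⨆ t, AllenCahn.energy W ε (ψ t)) ≤
        (⨆ t, AllenCahn.energy W ε (φ t)) + ENNReal.ofReal κ := by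
  have key : AllenCahn.NestedReach W ε
      ((⨆ t, AllenCahn.energy W ε (φ t)) + ENNReal.ofReal κ) (φ 0) (φ 1) := by
    -- If the supremum is infinite the energy bound is void, and the segment from `φ 0` to `min(φ 0,
    -- φ 1)` suffices.
    by_cases hΛ : (⨆ t, AllenCahn.energy W ε (φ t)) = ⊤
    · exact AllenCahn.nestedReach_of_lerp (hφ1 0) (hφ1 1) fun s => by simp [hΛ]
    · exact AllenCahn.nestedReach_of_continuousPath hW hε hφ hφ1 hΛ
        (le_iSup fun t => AllenCahn.energy W ε (φ t)) hκ
  obtain ⟨ψ, h1, h2, h3, h4, h5⟩ := key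
  exact ⟨ψ, h1, h2, h3, h4, iSup_le h5⟩
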